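/- Let $G>0$, let $N>1$, and let $\Omega_1,\dots,\Omega_N\subset\mathbb{R}^3$ be bounded, open, connected, nonempty sets with smooth boundary. Suppose that a plane $S\subset\mathbb{R}^3$ separates them: each $\Omega_\alpha$ lies in one of the two open half-spaces bounded by $S$, and each of the two half-spaces contains at least one $\Omega_\alpha$. Then the static Newtonian system of self-gravitating bodies occupying $\Omega_1,\dots,\Omega_N$ has no solution. That is, there are no - gravitational potential $U\in C^1(\mathbb{R}^3)$, - mass densities $\rho_\alpha\in L^\infty(\Omega_\alpha)$ with $\rho_\alpha>0$ on $\Omega_\alpha$ ($\alpha=1,\dots,N$), - symmetric Cauchy stress tensor fields $\sigma_{\alpha}=(\sigma_{\alpha\,ij})\in C^1(\Omega_\alpha)\cap C^0(\overline{\Omega_\alpha})$ ($\alpha=1,\dots,N$) such that $$\Delta U = 4\pi G\sum_{\alpha=1}^N \rho_\alpha\,\chi_{\Omega_\alpha}\ \text{ on }\mathbb{R}^3\text{ in the sense of distributions},\qquad U(x)\to 0\ \text{ as }|x|\to\infty,$$ and, for every $\alpha$ and $i=1,2,3$, $$\sum_{j=1}^3\partial_j\sigma_{\alpha\,ij} =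 \rho_\alpha\,\partial_i U\ \text{ in }\Omega_\alpha,\qquad \sum_{j=1}^3\sigma_{\alpha\,ij}\,n_j = 0\ \text{ on }\partial\Omega_\alpha,$$ where $n$ is the outer unit normal of $\partial\Omega_\alpha$. -/

import Mathlib

open MeasureTheory Filter Topology
open scoped ContDiff Gradient

namespace NewtonStatic

/-- Euclidean three-space. -/
abbrev E3 : Type := EuclideanSpace ℝ (Fin 3)

/-- The partial derivative `∂ᵢ f` at `x`. -/
noncomputable def pd (i : Fin 3) (f : E3 → ℝ) (x : E3) : ℝ :=
  fderiv ℝ f x (EuclideanSpace.single i 1)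

/-- `f` is a smooth defining function of the set `Ω` on the open neighbourhood `W` of `p`:
inside `W` the set `Ω` is `{f < 0}`, and the gradient of `f` has no zero in `W`. -/
structure IsLocalDefiningFunction (Ω : Set E3) (p : E3) (W : Set E3) (f : E3 → ℝ) : Prop where
  isOpen : IsOpen W
  mem : p ∈ W
  smooth : ContDiffOn ℝ ∞ f W
  gradient_ne_zero : ∀ x ∈ W, ∇ f x ≠ 0
  mem_iff : ∀ x ∈ W, (x ∈ Ω ↔ f x < 0)

/-- The boundary of the open set `Ω` is a smooth surface with `Ω` locally on one side of it. -/
def HasSmoothBoundary (Ω : Set E3) : Prop :=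
  ∀ p ∈ frontier Ω, ∃ (W : Set E3) (f : E3 → ℝ), IsLocalDefiningFunction Ω p W f

/-- `ν` is the outer unit normal of `Ω` at its boundary point `p`: the normalized gradient
of a local defining function. -/
def IsOuterUnitNormal (Ω : Set E3) (p ν : E3) : Prop :=
  ∃ (W : Set E3) (f : E3 → ℝ), IsLocalDefiningFunction Ω p W f ∧ ν = ‖∇ f p‖⁻¹ • ∇ f p

/-- The region occupied by a body: a bounded, open, connected (in particular nonempty) subset of
Euclidean three-space with smooth boundary. -/
structure IsBody (Ω : Set E3) : Prop where
  isBounded : Bornology.IsBounded Ω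
  isOpen : IsOpen Ω
  isConnected : IsConnected Ω
  smoothBoundary : HasSmoothBoundary Ω

/-- The plane `{x | ⟪n, x⟫ = c}` separates the bodies `Ω α`: every body lies in one of the two
open half-spaces bounded by the plane, and there are bodies on both sides. -/
def PlaneSeparates {N : ℕ} (Ω : Fin N → Set E3) (n : E3) (c : ℝ) : Prop :=
  (∀ α, (∀ x ∈ Ω α, inner ℝ n x < c) ∨ (∀ x ∈ Ω α, c < inner ℝ n x)) ∧
    (∃ α, ∀ x ∈ Ω α, inner ℝ n x < c) ∧ (∃ α, ∀ x ∈ Ω α, c < inner ℝ n x)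

/-- `U` solves `Δ U = 4 π G ∑ α, ρ α · χ_{Ω α}` in the sense of distributions on all of space
(the right-hand side jumps across the boundaries of the bodies). -/
def SolvesPoisson {N : ℕ} (G : ℝ) (Ω : Fin N → Set E3) (ρ : Fin N → E3 → ℝ) (U : E3 → ℝ) : Prop :=
  ∀ φ : E3 → ℝ, ContDiff ℝ ∞ φ → HasCompactSupport φ →
    ∫ x, U x * Laplacian.laplacian φ x = 4 * Real.pi * G * ∑ α, ∫ x in Ω α, ρ α x * φ x

/-- `(U, ρ, σ)` is a static solution of Newtonian gravity with bodies occupying the regions `Ω α`: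
`U` is the potential, `ρ α` is the mass density and `σ α` the Cauchy stress of the body `α`.
Only the values of `ρ α` on `Ω α` and those of `σ α` on the closure of `Ω α` matter. -/
structure IsStaticSolution {N : ℕ} (G : ℝ) (Ω : Fin N → Set E3) (U : E3 → ℝ)
    (ρ : Fin N → E3 → ℝ) (σ : Fin N → E3 → Matrix (Fin 3) (Fin 3) ℝ) : Prop where
  /-- The potential is continuously differentiable. -/
  contDiff_U : ContDiff ℝ 1 U
  /-- The densities are (essentially) bounded, measurable functions. -/
  bounded_density : ∀ α, MemLp (ρ α) ⊤ (volume.restrict (Ω α))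
  density_pos : ∀ α, ∀ x ∈ Ω α, 0 < ρ α x
  stress_symm : ∀ α, ∀ x ∈ Ω α, (σ α x).IsSymm
  /-- The stresses are continuously differentiable inside the bodies ... -/
  contDiff_stress : ∀ α i j, ContDiffOn ℝ 1 (fun x => σ α x i j) (Ω α)
  /-- ... and continuous up to the boundary. -/
  continuous_stress : ∀ α i j, ContinuousOn (fun x => σ α x i j) (closure (Ω α))
  /-- The Poisson equation. -/
  poisson : SolvesPoisson G Ω ρ U
  /-- The potential vanishes at infinity. -/
  tendsto_U : Tendsto U (cocompact E3) (𝓝 0)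
  /-- Balance of forces, `∂ʲ σᵢⱼ = ρ ∂ᵢ U` in each body. -/
  balance : ∀ α, ∀ x ∈ Ω α, ∀ i,
    ∑ j, pd j (fun y => σ α y i j) x = ρ α x * pd i U x
  /-- The normal stress vanishes on the boundary of each body, `σᵢⱼ νʲ = 0`. -/
  boundary : ∀ α, ∀ p ∈ frontier (Ω α), ∀ ν, IsOuterUnitNormal (Ω α) p ν →
    ∀ i, ∑ j, σ α p i j * ν j = 0

end NewtonStatic

/-!
A static solution would make the total gravitational force on each body vanish, while the bodies
on one side of the plane are pulled towards the plane by those on the other side.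

*Balance of forces.* Integrating `∂ʲ σᵢⱼ = ρ ∂ᵢ U` over a body gives `∫ ρ ∂ᵢ U = 0`, because the
normal stress vanishes on the boundary (`setIntegral_div_eq_zero`). The stress need not be
differentiable up to the boundary, so no surface integrals are used. The weak form of the equation
is tested near a boundary point against a cutoff that vanishes in a layer of thickness `ε` along
the boundary. The error is the integral over the layer of the normal component of the stress, which
tends to zero uniformly there, against a density whose mass stays bounded
(`integral_layerDensity_mul_le`). The local statements are glued with bump functions.

*Attraction.* Let `e` be normal to the plane. The kernel `⟨e, z⟩ / |z|³` of the force in direction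
`e` is harmonic away from the origin. Made smooth at two scales `δ < R`, it gives two kernels that
agree outside a ball, and their difference `ψ` is an admissible test function (`testKernel`).
Testing the Poisson equation with `ψ(· - x)` and integrating over the mass distribution of the
bodies below the plane gives
`∫ (T_δ - T_R) dm_A = 4 π G ∬ ψ(y - x) d(m_A + m_B)(y) dm_A(x)`,
where `T_s(x)` averages difference quotients of `U` at `x` and at scale `s` (`slopeAverage`).

On the left, `T_δ` tends to a derivative of `U` in a fixed direction as `δ → 0`, so its integral
tends to the total force on the bodies below, which is zero; and `T_R = O(1/R)` since `U` is
bounded. On the right, `ψ` is odd, so the `m_A`-`m_A` part vanishes, while for `R` large the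
`m_A`-`m_B` part is at least a positive multiple of `∬ ⟨e, y - x⟩ dm_B(y) dm_A(x) > 0`,
independent of `δ` (`le_testKernel`). This is a contradiction
(`false_of_separated_of_force_eq_zero`). No representation of `U` as a Newton potential is needed.
-/

namespace NewtonStatic

/-! ### Divergence theorem with compact support -/

theorem integral_fderiv_apply_eq_zero {u : E3 → ℝ} (hu : ContDiff ℝ 1 u)
    (hc : HasCompactSupport u) (w : E3) : ∫ x, fderiv ℝ u x w = 0 := by
  have hcont : Continuous fun x => fderiv ℝ u x w :=
    (hu.continuous_fderiv one_ne_zero).clm_apply continuous_const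
  have hsupp : HasCompactSupport fun x => fderiv ℝ u x w := hc.fderiv_apply ℝ w
  have h := integral_mul_fderiv_eq_neg_fderiv_mul_of_integrable (μ := volume)
    (f := fun _ : E3 => (1 : ℝ)) (g := u) (v := w)
    (by simp) (by simpa using hcont.integrable_of_hasCompactSupport hsupp)
    (by simpa using hu.continuous.integrable_of_hasCompactSupport hc)
    (fun _ _ => differentiableAt_const _) (fun _ _ => hu.differentiable one_ne_zero _)
  simpa using h

theorem pd_mul {f g : E3 → ℝ} {x : E3} (hf : DifferentiableAt ℝ f x)
    (hg : DifferentiableAt ℝ g x) (j : Fin 3) :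
    pd j (fun y => f y * g y) x = pd j f x * g x + f x * pd j g x := by
  simp only [pd]
  rw [fderiv_fun_mul hf hg]
  simp only [add_apply, smul_apply, smul_eq_mul]
  ring

theorem continuous_pd {f : E3 → ℝ} (hf : ContDiff ℝ 1 f) (j : Fin 3) : Continuous (pd j f) :=
  (hf.continuous_fderiv one_ne_zero).clm_apply continuous_const

theorem sum_mul_pd (f : E3 → ℝ) (x w : E3) : ∑ j, w j * pd j f x = fderiv ℝ f x w := by
  conv_rhs => rw [← (EuclideanSpace.basisFun (Fin 3) ℝ).sum_repr w]
  simp [pd, map_sum]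

theorem gradient_apply (f : E3 → ℝ) (x : E3) (j : Fin 3) : (∇ f x) j = pd j f x := by
  have h : inner ℝ (∇ f x) (EuclideanSpace.single j (1 : ℝ)) = pd j f x := by
    simp [gradient, pd]
  rw [EuclideanSpace.inner_single_right] at h
  simpa using h

/-- The weak form `∫_Ω (F χ + v · ∇χ)` of the equation `div v = F` with no flux of `v` through the
boundary of `Ω`, tested against `χ`. -/
noncomputable def weakDiv (Ω : Set E3) (F : E3 → ℝ) (v : Fin 3 → E3 → ℝ) (χ : E3 → ℝ) : ℝ :=
  ∫ x in Ω, (F x * χ x + ∑ j, v j x * pd j χ x)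

theorem weakDiv_eq_zero_of_tsupport_subset {Ω : Set E3} (hΩ : IsOpen Ω) {F : E3 → ℝ}
    {v : Fin 3 → E3 → ℝ} (hv : ∀ j, ContDiffOn ℝ 1 (v j) Ω)
    (hF : ∀ x ∈ Ω, ∑ j, pd j (v j) x = F x) {χ : E3 → ℝ} (hχ : ContDiff ℝ 1 χ)
    (hc : HasCompactSupport χ) (hs : tsupport χ ⊆ Ω) : weakDiv Ω F v χ = 0 := by
  have hzero : ∀ j, ∀ x ∉ tsupport χ, (fun y => v j y * χ y) =ᶠ[𝓝 x] fun _ => 0 := by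
    intro j x hx
    filter_upwards [(isClosed_tsupport χ).isOpen_compl.mem_nhds hx] with y hy
    rw [image_eq_zero_of_notMem_tsupport hy, mul_zero]
  have hcd : ∀ j, ContDiff ℝ 1 fun y => v j y * χ y := by
    intro j
    rw [contDiff_iff_contDiffAt]
    intro x
    by_cases hx : x ∈ tsupport χ
    · exact ((hv j).contDiffAt (hΩ.mem_nhds (hs hx))).mul hχ.contDiffAt
    · exact contDiffAt_const.congr_of_eventuallyEq (hzero j x hx)
  have hcs : ∀ j, HasCompactSupport fun y => v j y * χ y := fun j => hc.mul_left
  have hint : ∀ j, Integrable (pd j fun y => v j y * χ y) := fun j =>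
    (continuous_pd (hcd j) j).integrable_of_hasCompactSupport ((hcs j).fderiv_apply ℝ _)
  have h1 : weakDiv Ω F v χ = ∫ x in Ω, ∑ j, pd j (fun y => v j y * χ y) x := by
    refine setIntegral_congr_fun hΩ.measurableSet fun x hx => ?_
    have hd : ∀ j, DifferentiableAt ℝ (v j) x := fun j =>
      ((hv j).contDiffAt (hΩ.mem_nhds hx)).differentiableAt one_ne_zero
    rw [← hF x hx, Finset.sum_mul, ← Finset.sum_add_distrib]
    refine Finset.sum_congr rfl fun j _ => ?_
    rw [pd_mul (hd j) (hχ.differentiable one_ne_zero x)]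
  rw [h1, setIntegral_eq_integral_of_forall_compl_eq_zero, integral_finsetSum _ fun j _ => hint j]
  · exact Finset.sum_eq_zero fun j _ => integral_fderiv_apply_eq_zero (hcd j) (hcs j) _
  · intro x hx
    refine Finset.sum_eq_zero fun j _ => ?_
    rw [pd, (hzero j x fun h => hx (hs h)).fderiv_eq]
    simp

/-- Cutting off a local defining function makes it smooth on all of space, without changing it on a
smaller ball. -/
theorem exists_global_definingFunction {Ω : Set E3} {p : E3} {W : Set E3} {f₀ : E3 → ℝ}
    (h : IsLocalDefiningFunction Ω p W f₀) :
    ∃ r > 0, ∃ f : E3 → ℝ, ContDiff ℝ ∞ f ∧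
      ∀ x ∈ Metric.ball p r, IsLocalDefiningFunction Ω x (Metric.ball p r) f := by
  obtain ⟨R, hR, hRW⟩ := Metric.isOpen_iff.1 h.isOpen p h.mem
  let b : ContDiffBump p := ⟨R / 3, R / 2, by positivity, by linarith⟩
  have hsub : tsupport b ⊆ W := by
    rw [b.tsupport_eq]
    exact (Metric.closedBall_subset_ball (by change R / 2 < R; linarith)).trans hRW
  have heq : ∀ x ∈ Metric.ball p (R / 3), (fun y => b y * f₀ y) =ᶠ[𝓝 x] f₀ := by
    intro x hx
    filter_upwards [Metric.isOpen_ball.mem_nhds hx] with y hy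
    rw [b.one_of_mem_closedBall (Metric.ball_subset_closedBall hy), one_mul]
  have hballW : Metric.ball p (R / 3) ⊆ W :=
    (Metric.ball_subset_ball (by linarith)).trans hRW
  have hcd : ContDiff ℝ ∞ fun y => b y * f₀ y := by
    rw [contDiff_iff_contDiffAt]
    intro x
    by_cases hx : x ∈ tsupport b
    · exact b.contDiff.contDiffAt.mul (h.smooth.contDiffAt (h.isOpen.mem_nhds (hsub hx)))
    · refine (contDiffAt_const (c := (0 : ℝ))).congr_of_eventuallyEq ?_
      filter_upwards [(isClosed_tsupport b).isOpen_compl.mem_nhds hx] with y hy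
      rw [image_eq_zero_of_notMem_tsupport hy, zero_mul]
  refine ⟨R / 3, by positivity, _, hcd, fun x hx => ⟨Metric.isOpen_ball, hx, hcd.contDiffOn, ?_, ?_⟩⟩
  · intro y hy
    rw [gradient, (heq y hy).fderiv_eq]
    exact h.gradient_ne_zero y (hballW hy)
  · intro y hy
    rw [h.mem_iff y (hballW hy), show b y * f₀ y = f₀ y from (heq y hy).eq_of_nhds]

/-! ### Cutoffs along the boundary -/

/-- The smooth cutoff `S(-1 - f/ε)`, with `S` the smooth step from `0` to `1`: it is `1` where
`f ≤ -2ε` and `0` where `f ≥ -ε`. -/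
noncomputable def layerCutoff (f : E3 → ℝ) (ε : ℝ) (x : E3) : ℝ :=
  Real.smoothTransition (-1 - ε⁻¹ * f x)

/-- Up to sign, the derivative of `layerCutoff f ε` with respect to `f`; it lives on the layer
`-2ε ≤ f ≤ -ε`. -/
noncomputable def layerDensity (f : E3 → ℝ) (ε : ℝ) (x : E3) : ℝ :=
  ε⁻¹ * deriv Real.smoothTransition (-1 - ε⁻¹ * f x)

theorem layerDensity_nonneg {f : E3 → ℝ} {ε : ℝ} (hε : 0 < ε) (x : E3) :
    0 ≤ layerDensity f ε x :=
  mul_nonneg (by positivity) (Real.smoothTransition.monotone.deriv_nonneg)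

theorem contDiff_layerCutoff {f : E3 → ℝ} (hf : ContDiff ℝ ∞ f) (ε : ℝ) :
    ContDiff ℝ ∞ (layerCutoff f ε) :=
  (Real.smoothTransition.contDiff (n := ⊤)).comp
    (contDiff_const.sub (contDiff_const.mul hf))

theorem continuous_layerDensity {f : E3 → ℝ} (hf : ContDiff ℝ ∞ f) (ε : ℝ) :
    Continuous (layerDensity f ε) :=
  continuous_const.mul (((Real.smoothTransition.contDiff (n := 1)).continuous_deriv le_rfl).comp
    (continuous_const.sub (continuous_const.mul hf.continuous)))

theorem fderiv_layerCutoff {f : E3 → ℝ} (hf : ContDiff ℝ ∞ f) (ε : ℝ) (x w : E3) :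
    fderiv ℝ (layerCutoff f ε) x w = -(layerDensity f ε x * fderiv ℝ f x w) := by
  have hf' : HasFDerivAt f (fderiv ℝ f x) x := (hf.differentiable (by simp) x).hasFDerivAt
  have hS : HasDerivAt Real.smoothTransition
      (deriv Real.smoothTransition (-1 - ε⁻¹ * f x)) (-1 - ε⁻¹ * f x) :=
    ((Real.smoothTransition.contDiff (n := 1)).differentiable one_ne_zero _).hasDerivAt
  have h := hS.comp_hasFDerivAt x ((hf'.const_mul ε⁻¹).const_sub (-1))
  have h2 : fderiv ℝ (layerCutoff f ε) x = _ := h.fderiv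
  rw [h2, layerDensity]
  simp
  ring

theorem neg_two_mul_le_of_layerDensity_ne_zero {f : E3 → ℝ} {ε : ℝ} (hε : 0 < ε) {x : E3}
    (h : layerDensity f ε x ≠ 0) : -2 * ε ≤ f x := by
  by_contra! hlt
  refine h ?_
  have h1 : 1 < -1 - ε⁻¹ * f x := by
    have := mul_lt_mul_of_pos_left hlt (inv_pos.2 hε)
    rw [show ε⁻¹ * (-2 * ε) = -2 by field_simp] at this
    linarith
  have h2 : Real.smoothTransition =ᶠ[𝓝 (-1 - ε⁻¹ * f x)] fun _ => 1 := by
    filter_upwards [lt_mem_nhds h1] with t ht using Real.smoothTransition.one_of_one_le ht.le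
  rw [layerDensity, h2.deriv_eq]
  simp

theorem le_neg_of_layerCutoff_ne_zero {f : E3 → ℝ} {ε : ℝ} (hε : 0 < ε) {x : E3}
    (h : layerCutoff f ε x ≠ 0) : f x ≤ -ε := by
  by_contra! hlt
  refine h (Real.smoothTransition.zero_of_nonpos ?_)
  have := mul_lt_mul_of_pos_left hlt (inv_pos.2 hε)
  rw [show ε⁻¹ * -ε = -1 by field_simp] at this
  linarith

theorem abs_layerCutoff_le_one (f : E3 → ℝ) (ε : ℝ) (x : E3) : |layerCutoff f ε x| ≤ 1 := by
  rw [layerCutoff, abs_of_nonneg (Real.smoothTransition.nonneg _)]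
  exact Real.smoothTransition.le_one _

theorem tendsto_layerCutoff {f : E3 → ℝ} {x : E3} (hx : f x < 0) :
    Tendsto (fun ε => layerCutoff f ε x) (𝓝[>] 0) (𝓝 1) := by
  refine tendsto_const_nhds.congr' ?_
  filter_upwards [Ioo_mem_nhdsGT (show (0 : ℝ) < -f x / 2 by linarith)] with ε hε
  refine (Real.smoothTransition.one_of_one_le ?_).symm
  have h1 : 2 * ε ≤ - f x := by linarith [hε.2]
  have := mul_le_mul_of_nonneg_left h1 (inv_pos.2 hε.1).le
  rw [show ε⁻¹ * (2 * ε) = 2 by field_simp [hε.1.ne']] at this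
  linarith

/-- The mass of a layer of thickness `ε` along the surface `f = 0`, scaled by `ε⁻¹`, stays bounded:
integrate `∂_w (layerCutoff f ε · b)`, where `f` increases at a definite rate along `w`. -/
theorem integral_layerDensity_mul_le {f b : E3 → ℝ} (hf : ContDiff ℝ ∞ f) (hb : ContDiff ℝ ∞ b)
    (hbc : HasCompactSupport b) (hb0 : ∀ x, 0 ≤ b x) {w : E3} {c : ℝ}
    (hw : ∀ x ∈ tsupport b, c ≤ fderiv ℝ f x w) {ε : ℝ} (hε : 0 < ε) :
    c * ∫ x, layerDensity f ε x * b x ≤ ∫ x, |fderiv ℝ b x w| := by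
  have hη := contDiff_layerCutoff hf ε
  have hdb : Continuous fun x => fderiv ℝ b x w :=
    (hb.continuous_fderiv (by simp)).clm_apply continuous_const
  have hdbc : HasCompactSupport fun x => fderiv ℝ b x w := hbc.fderiv_apply ℝ w
  have hdf : Continuous fun x => fderiv ℝ f x w :=
    (hf.continuous_fderiv (by simp)).clm_apply continuous_const
  have hs := continuous_layerDensity hf ε
  have h0 : ∫ x, fderiv ℝ (fun y => layerCutoff f ε y * b y) x w = 0 :=
    integral_fderiv_apply_eq_zero ((hη.mul hb).of_le (by simp)) hbc.mul_left w
  have h1 : ∀ x, fderiv ℝ (fun y => layerCutoff f ε y * b y) x w =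
      layerCutoff f ε x * fderiv ℝ b x w - layerDensity f ε x * b x * fderiv ℝ f x w := by
    intro x
    rw [fderiv_fun_mul (hη.differentiable (by simp) x) (hb.differentiable (by simp) x)]
    simp only [add_apply, smul_apply, smul_eq_mul]
    rw [fderiv_layerCutoff hf]
    ring
  have hi1 : Integrable fun x => layerCutoff f ε x * fderiv ℝ b x w :=
    (hη.continuous.mul hdb).integrable_of_hasCompactSupport hdbc.mul_left
  have hi2 : Integrable fun x => layerDensity f ε x * b x * fderiv ℝ f x w :=
    ((hs.mul hb.continuous).mul hdf).integrable_of_hasCompactSupport (hbc.mul_left.mul_right)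
  have hi3 : Integrable fun x => c * (layerDensity f ε x * b x) :=
    ((hs.mul hb.continuous).integrable_of_hasCompactSupport hbc.mul_left).const_mul c
  simp_rw [h1] at h0
  rw [integral_sub hi1 hi2, sub_eq_zero] at h0
  rw [← integral_const_mul]
  calc ∫ x, c * (layerDensity f ε x * b x)
      ≤ ∫ x, layerDensity f ε x * b x * fderiv ℝ f x w := by
        refine integral_mono hi3 hi2 fun x => ?_
        by_cases hx : x ∈ tsupport b
        · have := mul_le_mul_of_nonneg_left (hw x hx)
            (mul_nonneg (layerDensity_nonneg (f := f) hε x) (hb0 x))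
          simp only
          linarith
        · simp [image_eq_zero_of_notMem_tsupport hx]
    _ = ∫ x, layerCutoff f ε x * fderiv ℝ b x w := h0.symm
    _ ≤ ∫ x, |fderiv ℝ b x w| := by
        refine integral_mono hi1 (hdb.abs.integrable_of_hasCompactSupport hdbc.abs) fun x => ?_
        simp only
        calc _ ≤ |layerCutoff f ε x * fderiv ℝ b x w| := le_abs_self _
          _ ≤ _ := by
            rw [abs_mul]
            exact mul_le_of_le_one_left (abs_nonneg _) (abs_layerCutoff_le_one f ε x)

theorem integrableOn_weakDiv {Ω : Set E3} (hb : Bornology.IsBounded Ω) (hΩ : IsOpen Ω)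
    {F : E3 → ℝ} {v : Fin 3 → E3 → ℝ} (hF : IntegrableOn F Ω)
    (hv : ∀ j, ContinuousOn (v j) (closure Ω)) {χ : E3 → ℝ} (hχ : ContDiff ℝ 1 χ) :
    IntegrableOn (fun x => F x * χ x + ∑ j, v j x * pd j χ x) Ω := by
  have hK : IsCompact (closure Ω) := hb.isCompact_closure
  refine Integrable.add ?_ (integrable_finsetSum _ fun j _ => ?_)
  · exact hF.mul_continuousOn_of_subset hχ.continuous.continuousOn hΩ.measurableSet hK
      subset_closure
  · exact (((hv j).mul (continuous_pd hχ j).continuousOn).integrableOn_compact hK).mono_set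
      subset_closure

/-! ### Divergence theorem for fields tangential at the boundary -/

theorem weakDiv_layerCutoff_mul {Ω : Set E3} (hb : Bornology.IsBounded Ω) (hΩ : IsOpen Ω)
    {F : E3 → ℝ} {v : Fin 3 → E3 → ℝ} (hF : IntegrableOn F Ω)
    (hv : ∀ j, ContinuousOn (v j) (closure Ω)) {f χ : E3 → ℝ} (hf : ContDiff ℝ ∞ f)
    (hχ : ContDiff ℝ ∞ χ) (ε : ℝ) :
    weakDiv Ω F v (fun x => layerCutoff f ε x * χ x) =
      (∫ x in Ω, layerCutoff f ε x * (F x * χ x + ∑ j, v j x * pd j χ x)) -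
        ∫ x in Ω, layerDensity f ε x * χ x * ∑ j, v j x * pd j f x := by
  have hK : IsCompact (closure Ω) := hb.isCompact_closure
  have hη := contDiff_layerCutoff hf ε
  rw [← integral_sub]
  · refine setIntegral_congr_fun hΩ.measurableSet fun x _ => ?_
    have h1 : ∀ j, pd j (fun y => layerCutoff f ε y * χ y) x =
        layerCutoff f ε x * pd j χ x - layerDensity f ε x * χ x * pd j f x := by
      intro j
      rw [pd_mul (hη.differentiable (by simp) x) (hχ.differentiable (by simp) x), pd,
        fderiv_layerCutoff hf, pd, pd]
      ring
    simp only [h1]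
    simp only [mul_add, mul_sub, Finset.sum_sub_distrib, Finset.mul_sum]
    rw [← add_sub_assoc]
    congr 1
    · congr 1
      · ring
      · exact Finset.sum_congr rfl fun j _ => by ring
    · exact Finset.sum_congr rfl fun j _ => by ring
  · exact ((integrableOn_weakDiv hb hΩ hF hv (hχ.of_le (by simp))).mul_continuousOn_of_subset
      hη.continuous.continuousOn hΩ.measurableSet hK subset_closure).congr
        (Eventually.of_forall fun x => mul_comm _ _)
  · have hc : ContinuousOn
        (fun x => layerDensity f ε x * χ x * ∑ j, v j x * pd j f x) (closure Ω) :=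
      ((continuous_layerDensity hf ε).mul hχ.continuous).continuousOn.mul
        (continuousOn_finsetSum _ fun j _ =>
          (hv j).mul (continuous_pd (hf.of_le (by simp)) j).continuousOn)
    exact (hc.integrableOn_compact hK).mono_set subset_closure

/-- Near a boundary point the weak equation holds up to the boundary: test against
`layerCutoff f ε · χ` and let `ε → 0`. The error is the integral over the layer of the normal
component of `v`, which is uniformly small there, against a density of bounded mass. -/
theorem exists_weakDiv_mul_eq_zero {Ω : Set E3} (hb : Bornology.IsBounded Ω) (hΩ : IsOpen Ω)
    (hsm : HasSmoothBoundary Ω) {F : E3 → ℝ} {v : Fin 3 → E3 → ℝ} (hF : IntegrableOn F Ω)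
    (hv : ∀ j, ContDiffOn ℝ 1 (v j) Ω) (hvc : ∀ j, ContinuousOn (v j) (closure Ω))
    (hdiv : ∀ x ∈ Ω, ∑ j, pd j (v j) x = F x)
    (hbd : ∀ p ∈ frontier Ω, ∀ ν, IsOuterUnitNormal Ω p ν → ∑ j, v j p * ν j = 0)
    {p : E3} (hp : p ∈ frontier Ω) :
    ∃ r > 0, ∀ b : E3 → ℝ, ContDiff ℝ ∞ b → HasCompactSupport b → (∀ x, 0 ≤ b x) →
      tsupport b ⊆ Metric.ball p r → ∀ φ : E3 → ℝ, ContDiff ℝ ∞ φ →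
        weakDiv Ω F v (fun x => φ x * b x) = 0 := by
  obtain ⟨W, f₀, h₀⟩ := hsm p hp
  obtain ⟨r₁, hr₁, f, hf, hdef⟩ := exists_global_definingFunction h₀
  set w : E3 := ∇ f p with hw
  have hw0 : 0 < ‖w‖ ^ 2 := by
    have := (hdef p (Metric.mem_ball_self hr₁)).gradient_ne_zero p (Metric.mem_ball_self hr₁)
    positivity
  have hwp : fderiv ℝ f p w = ‖w‖ ^ 2 := by
    have h (y : E3) : fderiv ℝ f p y = inner ℝ w y := by simp [hw, gradient]
    rw [h, real_inner_self_eq_norm_sq]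
  have hcont : Continuous fun x => fderiv ℝ f x w :=
    (hf.continuous_fderiv (by simp)).clm_apply continuous_const
  obtain ⟨r₂, hr₂, hr₂w⟩ := Metric.eventually_nhds_iff_ball.1
    (hcont.continuousAt.eventually (lt_mem_nhds (show ‖w‖ ^ 2 / 2 < fderiv ℝ f p w by
      rw [hwp]; linarith)))
  refine ⟨min r₁ r₂, lt_min hr₁ hr₂, fun b hbs hbc hb0 hbsub φ hφ => ?_⟩
  have hsub1 : tsupport b ⊆ Metric.ball p r₁ :=
    hbsub.trans (Metric.ball_subset_ball (min_le_left _ _))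
  have hsub2 : tsupport b ⊆ Metric.ball p r₂ :=
    hbsub.trans (Metric.ball_subset_ball (min_le_right _ _))
  have hmem : ∀ x ∈ Metric.ball p r₁, (x ∈ Ω ↔ f x < 0) :=
    (hdef p (Metric.mem_ball_self hr₁)).mem_iff
  set χ : E3 → ℝ := fun x => φ x * b x with hχdef
  have hχ : ContDiff ℝ ∞ χ := hφ.mul hbs
  set g : E3 → ℝ := fun x => ∑ j, v j x * pd j f x with hg
  have hgc : ContinuousOn g (closure Ω) := continuousOn_finsetSum _ fun j _ =>
    (hvc j).mul (continuous_pd (hf.of_le (by simp)) j).continuousOn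
  -- The boundary condition, in the form that the normal component of `v` vanishes.
  have hg0 : ∀ x ∈ closure Ω, x ∈ tsupport b → 0 ≤ f x → g x = 0 := by
    intro x hx hxb hfx
    have hxΩ : x ∉ Ω := fun h => absurd ((hmem x (hsub1 hxb)).1 h) (not_lt.2 hfx)
    have hd := hdef x (hsub1 hxb)
    have hfr : x ∈ frontier Ω := by
      rw [frontier, hΩ.interior_eq]
      exact ⟨hx, hxΩ⟩
    have h := hbd x hfr _ ⟨_, f, hd, rfl⟩
    have hne : ‖∇ f x‖⁻¹ ≠ 0 := by
      simpa using hd.gradient_ne_zero x (hsub1 hxb)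
    have h2 : ‖∇ f x‖⁻¹ * g x = 0 := by
      rw [← h, hg, Finset.mul_sum]
      refine Finset.sum_congr rfl fun j _ => ?_
      rw [PiLp.smul_apply, gradient_apply, smul_eq_mul]
      ring
    exact (mul_eq_zero.1 h2).resolve_left hne
  have hKc : IsCompact (closure Ω ∩ tsupport b) := hb.isCompact_closure.inter hbc
  have hgcK : ContinuousOn g (closure Ω ∩ tsupport b) := hgc.mono Set.inter_subset_left
  -- Uniform smallness of the normal component in thin layers.
  have hunif : ∀ τ > 0, ∃ ε₀ > 0, ∀ x ∈ closure Ω ∩ tsupport b, -ε₀ < f x → |g x| ≤ τ := by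
    intro τ hτ
    have hZ : IsCompact ((closure Ω ∩ tsupport b) ∩ (fun x => |g x|) ⁻¹' Set.Ici τ) :=
      hKc.of_isClosed_subset (hgcK.abs.preimage_isClosed_of_isClosed hKc.isClosed isClosed_Ici)
        Set.inter_subset_left
    rcases Set.eq_empty_or_nonempty
      ((closure Ω ∩ tsupport b) ∩ (fun x => |g x|) ⁻¹' Set.Ici τ) with he | hne
    · refine ⟨1, one_pos, fun x hx _ => ?_⟩
      by_contra! hlt
      exact Set.notMem_empty x (he ▸ ⟨hx, hlt.le⟩)
    · obtain ⟨y, hy, hmax⟩ := hZ.exists_isMaxOn hne hf.continuous.continuousOn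
      have hfy : f y < 0 := by
        by_contra! hle
        have h1 : τ ≤ |g y| := hy.2
        rw [hg0 y hy.1.1 hy.1.2 hle, abs_zero] at h1
        linarith
      refine ⟨-f y, by linarith, fun x hx hxf => ?_⟩
      by_contra! hlt
      have h1 : f x ≤ f y := hmax ⟨hx, hlt.le⟩
      linarith
  obtain ⟨M, hM⟩ := hKc.exists_bound_of_continuousOn hφ.continuous.continuousOn
  set C : ℝ := ∫ x, |fderiv ℝ b x w| with hC
  have hmass : ∀ ε > 0, ∫ x, layerDensity f ε x * b x ≤ C / (‖w‖ ^ 2 / 2) := by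
    intro ε hε
    rw [le_div_iff₀ (by positivity), mul_comm]
    exact integral_layerDensity_mul_le hf hbs hbc hb0
      (fun x hx => (hr₂w x (hsub2 hx)).le) hε
  set A : ℝ → ℝ := fun ε => ∫ x in Ω, layerCutoff f ε x * (F x * χ x + ∑ j, v j x * pd j χ x)
  set B : ℝ → ℝ := fun ε => ∫ x in Ω, layerDensity f ε x * χ x * g x
  have hAB : ∀ ε > 0, A ε = B ε := by
    intro ε hε
    have h1 := weakDiv_layerCutoff_mul hb hΩ hF hvc hf hχ ε
    have hcl : IsClosed (tsupport b ∩ {x | f x ≤ -ε}) :=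
      (isClosed_tsupport b).inter (isClosed_le hf.continuous continuous_const)
    have hts : tsupport (fun x => layerCutoff f ε x * χ x) ⊆ tsupport b ∩ {x | f x ≤ -ε} := by
      refine closure_minimal (fun x hx => ?_) hcl
      have hx' : layerCutoff f ε x * (φ x * b x) ≠ 0 := hx
      exact ⟨subset_tsupport b (right_ne_zero_of_mul (right_ne_zero_of_mul hx')),
        le_neg_of_layerCutoff_ne_zero hε (left_ne_zero_of_mul hx')⟩
    have h2 : weakDiv Ω F v (fun x => layerCutoff f ε x * χ x) = 0 := by
      refine weakDiv_eq_zero_of_tsupport_subset hΩ hv hdiv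
        (((contDiff_layerCutoff hf ε).mul hχ).of_le (by simp))
        (hbc.mul_left.mul_left) fun x hx => ?_
      have := hts hx
      exact (hmem x (hsub1 this.1)).2 (lt_of_le_of_lt this.2 (by linarith))
    rw [h2] at h1
    linarith
  have hA : Tendsto A (𝓝[>] 0) (𝓝 (weakDiv Ω F v χ)) := by
    have hint := integrableOn_weakDiv hb hΩ hF hvc (hχ.of_le (by simp))
    refine tendsto_integral_filter_of_dominated_convergence
      (fun x => |F x * χ x + ∑ j, v j x * pd j χ x|) ?_ ?_ hint.abs ?_
    · exact Eventually.of_forall fun ε =>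
        (contDiff_layerCutoff hf ε).continuous.aestronglyMeasurable.mul hint.aestronglyMeasurable
    · refine Eventually.of_forall fun ε => Eventually.of_forall fun x => ?_
      rw [Real.norm_eq_abs, abs_mul]
      exact mul_le_of_le_one_left (abs_nonneg _) (abs_layerCutoff_le_one f ε x)
    · filter_upwards [ae_restrict_mem hΩ.measurableSet] with x hx
      by_cases hxb : x ∈ tsupport b
      · simpa using (tendsto_layerCutoff ((hmem x (hsub1 hxb)).1 hx)).mul_const
          (F x * χ x + ∑ j, v j x * pd j χ x)
      · have hz : χ =ᶠ[𝓝 x] fun _ => 0 := by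
          filter_upwards [(isClosed_tsupport b).isOpen_compl.mem_nhds hxb] with y hy
          rw [hχdef]
          simp [image_eq_zero_of_notMem_tsupport hy]
        simp [hz.eq_of_nhds, pd, hz.fderiv_eq]
  have hB : Tendsto B (𝓝[>] 0) (𝓝 0) := by
    rw [Metric.tendsto_nhds]
    intro δ hδ
    set D : ℝ := |M| * (C / (‖w‖ ^ 2 / 2)) with hD
    have hC0 : 0 ≤ C := integral_nonneg fun _ => abs_nonneg _
    have hD0 : 0 ≤ D := by positivity
    obtain ⟨ε₀, hε₀, hτ⟩ := hunif (δ / (D + 1)) (by positivity)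
    filter_upwards [Ioo_mem_nhdsGT (show (0 : ℝ) < ε₀ / 2 by linarith)] with ε hε
    have hsb : Integrable fun x => layerDensity f ε x * b x :=
      ((continuous_layerDensity hf ε).mul hbs.continuous).integrable_of_hasCompactSupport
        hbc.mul_left
    rw [dist_zero_right]
    calc ‖B ε‖ ≤ ∫ x in Ω, |M| * (δ / (D + 1)) * (layerDensity f ε x * b x) := by
          refine norm_integral_le_of_norm_le (hsb.const_mul _).integrableOn ?_
          filter_upwards [ae_restrict_mem hΩ.measurableSet] with x hx
          have hs0 := layerDensity_nonneg (f := f) hε.1 x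
          by_cases hz : layerDensity f ε x = 0 ∨ x ∉ tsupport b
          · have : layerDensity f ε x * b x = 0 := by
              rcases hz with h | h
              · simp [h]
              · simp [image_eq_zero_of_notMem_tsupport h]
            have h2 : layerDensity f ε x * χ x = 0 := by
              rw [hχdef]; simp only; rw [mul_left_comm, this, mul_zero]
            rw [h2, this]; simp
          · push Not at hz
            have hxK : x ∈ closure Ω ∩ tsupport b := ⟨subset_closure hx, hz.2⟩
            have h1 : |g x| ≤ δ / (D + 1) := hτ x hxK (by
              have := neg_two_mul_le_of_layerDensity_ne_zero hε.1 hz.1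
              linarith [hε.2])
            have h2 : |φ x| ≤ |M| := (hM x hxK).trans (le_abs_self _)
            rw [Real.norm_eq_abs, abs_mul, abs_mul, abs_of_nonneg hs0, hχdef]
            simp only
            rw [abs_mul, abs_of_nonneg (hb0 x)]
            have h3 : |φ x| * |g x| ≤ |M| * (δ / (D + 1)) :=
              mul_le_mul h2 h1 (abs_nonneg _) (abs_nonneg _)
            have h4 := mul_le_mul_of_nonneg_right h3 (mul_nonneg hs0 (hb0 x))
            linarith
      _ ≤ ∫ x, |M| * (δ / (D + 1)) * (layerDensity f ε x * b x) :=
          setIntegral_le_integral (hsb.const_mul _) (Eventually.of_forall fun x =>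
            mul_nonneg (by positivity) (mul_nonneg (layerDensity_nonneg hε.1 x) (hb0 x)))
      _ ≤ |M| * (δ / (D + 1)) * (C / (‖w‖ ^ 2 / 2)) := by
          rw [integral_const_mul]
          exact mul_le_mul_of_nonneg_left (hmass ε hε.1) (by positivity)
      _ = δ * (D / (D + 1)) := by rw [hD]; ring
      _ < δ := by
          refine mul_lt_of_lt_one_right hδ ?_
          rw [div_lt_one (by positivity)]
          linarith
  refine tendsto_nhds_unique hA (hB.congr' ?_)
  filter_upwards [self_mem_nhdsWithin] with ε hε using (hAB ε hε).symm

/-- The divergence theorem for a field without normal component at the boundary. -/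
theorem setIntegral_div_eq_zero {Ω : Set E3} (hb : Bornology.IsBounded Ω) (hΩ : IsOpen Ω)
    (hsm : HasSmoothBoundary Ω) {F : E3 → ℝ} {v : Fin 3 → E3 → ℝ} (hF : IntegrableOn F Ω)
    (hv : ∀ j, ContDiffOn ℝ 1 (v j) Ω) (hvc : ∀ j, ContinuousOn (v j) (closure Ω))
    (hdiv : ∀ x ∈ Ω, ∑ j, pd j (v j) x = F x)
    (hbd : ∀ p ∈ frontier Ω, ∀ ν, IsOuterUnitNormal Ω p ν → ∑ j, v j p * ν j = 0) :
    ∫ x in Ω, F x = 0 := by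
  have hlocal : ∀ p ∈ closure Ω, ∃ b : ContDiffBump p, ∀ φ : E3 → ℝ, ContDiff ℝ ∞ φ →
      weakDiv Ω F v (fun x => φ x * b x) = 0 := by
    intro p hp
    by_cases hpΩ : p ∈ Ω
    · obtain ⟨r, hr, hrΩ⟩ := Metric.isOpen_iff.1 hΩ p hpΩ
      let b : ContDiffBump p := ⟨r / 3, r / 2, by positivity, by linarith⟩
      refine ⟨b, fun φ hφ => weakDiv_eq_zero_of_tsupport_subset hΩ hv hdiv
        ((hφ.mul b.contDiff).of_le (by simp)) b.hasCompactSupport.mul_left ?_⟩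
      refine (closure_mono (Function.support_mul_subset_right φ b)).trans ?_
      change tsupport b ⊆ Ω
      rw [b.tsupport_eq]
      exact (Metric.closedBall_subset_ball (by change r / 2 < r; linarith)).trans hrΩ
    · have hfr : p ∈ frontier Ω := by
        rw [frontier, hΩ.interior_eq]
        exact ⟨hp, hpΩ⟩
      obtain ⟨r, hr, h⟩ := exists_weakDiv_mul_eq_zero hb hΩ hsm hF hv hvc hdiv hbd hfr
      let b : ContDiffBump p := ⟨r / 3, r / 2, by positivity, by linarith⟩
      refine ⟨b, h b b.contDiff b.hasCompactSupport (fun x => b.nonneg) ?_⟩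
      rw [b.tsupport_eq]
      exact Metric.closedBall_subset_ball (by change r / 2 < r; linarith)
  choose! b hbz using hlocal
  obtain ⟨t, ht, htc⟩ := hb.isCompact_closure.elim_nhds_subcover
    (fun p => Metric.ball p (b p).rIn) fun p _ => Metric.ball_mem_nhds p (b p).rIn_pos
  -- Multiplying the test function by `1 - b p` does not change the weak form.
  have hprod : ∀ s ⊆ t, ContDiff ℝ ∞ (fun x => ∏ p ∈ s, (1 - b p x)) ∧
      weakDiv Ω F v (fun x => ∏ p ∈ s, (1 - b p x)) = ∫ x in Ω, F x := by
    intro s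
    induction s using Finset.induction_on with
    | empty => exact fun _ => ⟨by simpa using contDiff_const, by simp [weakDiv, pd]⟩
    | insert p s hps ih =>
      intro hst
      obtain ⟨hsc, hse⟩ := ih ((Finset.subset_insert p s).trans hst)
      have hbp : ContDiff ℝ ∞ (b p) := (b p).contDiff
      set φ : E3 → ℝ := fun x => ∏ q ∈ s, (1 - b q x) with hφ
      have hins : (fun x => ∏ q ∈ insert p s, (1 - b q x)) = fun x => φ x - φ x * b p x := by
        ext x
        rw [Finset.prod_insert hps, hφ]
        ring
      rw [hins]
      refine ⟨hsc.sub (hsc.mul hbp), ?_⟩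
      have hz : weakDiv Ω F v (fun x => φ x * b p x) = 0 :=
        hbz p (ht p (hst (Finset.mem_insert_self p s))) φ hsc
      rw [← hse, ← sub_zero (weakDiv Ω F v φ), ← hz, weakDiv, weakDiv, weakDiv,
        ← integral_sub (integrableOn_weakDiv hb hΩ hF hvc (hsc.of_le (by simp)))
          (integrableOn_weakDiv hb hΩ hF hvc ((hsc.mul hbp).of_le (by simp)))]
      refine setIntegral_congr_fun hΩ.measurableSet fun x _ => ?_
      have hpd : ∀ j, pd j (fun y => φ y - φ y * b p y) x =
          pd j φ x - pd j (fun y => φ y * b p y) x := by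
        intro j
        rw [pd, fderiv_fun_sub (hsc.differentiable (by simp) x)
          ((hsc.mul hbp).differentiable (by simp) x)]
        rfl
      simp only [hpd, mul_sub, Finset.sum_sub_distrib]
      ring
  rw [← (hprod t subset_rfl).2, weakDiv]
  refine setIntegral_eq_zero_of_forall_eq_zero fun x hx => ?_
  have hz : (fun x => ∏ p ∈ t, (1 - b p x)) =ᶠ[𝓝 x] fun _ => 0 := by
    obtain ⟨p, hpt, hxp⟩ := Set.mem_iUnion₂.1 (htc (subset_closure hx))
    filter_upwards [Metric.isOpen_ball.mem_nhds hxp] with y hy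
    refine Finset.prod_eq_zero hpt ?_
    rw [(b p).one_of_mem_closedBall (Metric.ball_subset_closedBall hy), sub_self]
  simp [pd, hz.fderiv_eq, hz.eq_of_nhds]

/-! ### Laplacians and the force kernel of Newtonian gravity -/

theorem contDiff_pd {f : E3 → ℝ} (hf : ContDiff ℝ ∞ f) (i : Fin 3) : ContDiff ℝ ∞ (pd i f) :=
  (hf.fderiv_right (m := ∞) (by simp)).clm_apply contDiff_const

theorem two_le_infty : (2 : WithTop ℕ∞) ≤ ∞ := by
  have h : ((2 : ℕ∞) : WithTop ℕ∞) ≤ ((⊤ : ℕ∞) : WithTop ℕ∞) := WithTop.coe_le_coe.2 le_top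
  exact h

theorem laplacian_eq_sum_pd {f : E3 → ℝ} {x : E3} (hf : ContDiffAt ℝ 2 f x) :
    Laplacian.laplacian f x = ∑ i, pd i (pd i f) x := by
  rw [InnerProductSpace.laplacian_eq_iteratedFDeriv_orthonormalBasis f
    (EuclideanSpace.basisFun (Fin 3) ℝ)]
  refine Finset.sum_congr rfl fun i _ => ?_
  rw [iteratedFDeriv_two_apply]
  have hd : DifferentiableAt ℝ (fderiv ℝ f) x :=
    (hf.fderiv_right (m := 1) (by norm_num)).differentiableAt one_ne_zero
  have h : pd i (pd i f) x = fderiv ℝ (fun y => fderiv ℝ f y (EuclideanSpace.single i 1)) x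
      (EuclideanSpace.single i 1) := rfl
  rw [h, fderiv_clm_apply hd (differentiableAt_const _)]
  simp

theorem pd_comp_affine {f : E3 → ℝ} (hf : Differentiable ℝ f) (c : ℝ) (a y : E3) (i : Fin 3) :
    pd i (fun y => f (c • (y - a))) y = c * pd i f (c • (y - a)) := by
  have h1 : HasFDerivAt (fun y : E3 => c • (y - a)) (c • ContinuousLinearMap.id ℝ E3) y :=
    ((hasFDerivAt_id y).sub_const a).const_smul c
  have h2 := (hf (c • (y - a))).hasFDerivAt.comp y h1
  have h3 : fderiv ℝ (fun y => f (c • (y - a))) y = _ := h2.fderiv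
  rw [pd, h3]
  simp [pd]

theorem contDiff_comp_affine {f : E3 → ℝ} (hf : ContDiff ℝ ∞ f) (c : ℝ) (a : E3) :
    ContDiff ℝ ∞ fun y => f (c • (y - a)) :=
  hf.comp ((contDiff_id.sub contDiff_const).const_smul c)

theorem laplacian_comp_affine {f : E3 → ℝ} (hf : ContDiff ℝ ∞ f) (c : ℝ) (a y : E3) :
    Laplacian.laplacian (fun y => f (c • (y - a))) y =
      c ^ 2 * Laplacian.laplacian f (c • (y - a)) := by
  rw [laplacian_eq_sum_pd ((contDiff_comp_affine hf c a).contDiffAt.of_le two_le_infty),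
    laplacian_eq_sum_pd (hf.contDiffAt.of_le two_le_infty), Finset.mul_sum]
  refine Finset.sum_congr rfl fun i _ => ?_
  have h1 : pd i (fun y => f (c • (y - a))) = fun y => c * pd i f (c • (y - a)) := by
    ext y
    exact pd_comp_affine (hf.differentiable (by simp)) c a y i
  have hd : Differentiable ℝ (pd i f) := (contDiff_pd hf i).differentiable (by simp)
  have h2 : Differentiable ℝ fun y => pd i f (c • (y - a)) :=
    (contDiff_comp_affine (contDiff_pd hf i) c a).differentiable (by simp)
  rw [h1, pd, fderiv_const_mul (h2 y)]
  have h3 := pd_comp_affine hd c a y i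
  rw [pd] at h3
  rw [smul_apply, h3, smul_eq_mul]
  ring

theorem hasFDerivAt_comp_norm_sq {k : ℝ → ℝ} {k' : ℝ} {z : E3}
    (hk : HasDerivAt k k' (‖z‖ ^ 2)) :
    HasFDerivAt (fun y : E3 => k (‖y‖ ^ 2)) (k' • (2 • innerSL ℝ z)) z :=
  hk.comp_hasFDerivAt z (hasStrictFDerivAt_norm_sq z).hasFDerivAt

theorem pd_comp_norm_sq {k : ℝ → ℝ} {k' : ℝ} {z : E3} (hk : HasDerivAt k k' (‖z‖ ^ 2))
    (i : Fin 3) : pd i (fun y : E3 => k (‖y‖ ^ 2)) z = 2 * k' * z i := by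
  rw [pd, (hasFDerivAt_comp_norm_sq hk).fderiv]
  simp [EuclideanSpace.inner_single_right]
  ring

theorem pd_inner (e z : E3) (i : Fin 3) : pd i (fun y => inner ℝ e y) z = e i := by
  have h : HasFDerivAt (fun y : E3 => inner ℝ e y) (innerSL ℝ e) z :=
    (innerSL ℝ e).hasFDerivAt
  rw [pd, h.fderiv]
  simp [EuclideanSpace.inner_single_right]

theorem pd_coord (z : E3) (i : Fin 3) : pd i (fun y : E3 => y i) z = 1 := by
  have h : HasFDerivAt (fun y : E3 => y i)
      (EuclideanSpace.proj (𝕜 := ℝ) i : E3 →L[ℝ] ℝ) z :=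
    (EuclideanSpace.proj (𝕜 := ℝ) i : E3 →L[ℝ] ℝ).hasFDerivAt
  rw [pd, h.fderiv]
  simp

/-- The derivative `z ↦ ⟨e, z⟩ / |z|³` of the Newton kernel is harmonic away from the origin. -/
theorem laplacian_inner_mul_norm_sq_rpow (e : E3) {z : E3} (hz : z ≠ 0) :
    Laplacian.laplacian (fun y : E3 => inner ℝ e y * (‖y‖ ^ 2) ^ (-3 / 2 : ℝ)) z = 0 := by
  set k : ℝ → ℝ := fun s => s ^ (-3 / 2 : ℝ) with hk
  set k₁ : ℝ → ℝ := fun s => (-3 / 2) * s ^ (-5 / 2 : ℝ) with hk₁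
  set k₂ : ℝ → ℝ := fun s => (15 / 4) * s ^ (-7 / 2 : ℝ) with hk₂
  have hpos : ∀ y : E3, y ≠ 0 → 0 < ‖y‖ ^ 2 := fun y hy => by positivity
  have hdk : ∀ s > 0, HasDerivAt k (k₁ s) s := by
    intro s hs
    have h := Real.hasDerivAt_rpow_const (p := (-3 / 2 : ℝ)) (Or.inl hs.ne')
    rwa [show (-3 / 2 - 1 : ℝ) = -5 / 2 by norm_num] at h
  have hdk₁ : ∀ s > 0, HasDerivAt k₁ (k₂ s) s := by
    intro s hs
    have h := (Real.hasDerivAt_rpow_const (p := (-5 / 2 : ℝ)) (Or.inl hs.ne')).const_mul (-3 / 2)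
    rw [show (-5 / 2 - 1 : ℝ) = -7 / 2 by norm_num, ← mul_assoc] at h
    rwa [show (-3 / 2 * (-5 / 2) : ℝ) = 15 / 4 by norm_num] at h
  have hlin : ∀ y : E3, DifferentiableAt ℝ (fun y : E3 => inner ℝ e y) y := fun y =>
    (innerSL ℝ e).differentiableAt
  have hcoord : ∀ (i : Fin 3) (y : E3), DifferentiableAt ℝ (fun y : E3 => y i) y := fun i y =>
    (EuclideanSpace.proj (𝕜 := ℝ) i : E3 →L[ℝ] ℝ).differentiableAt
  have hrad : ∀ y : E3, y ≠ 0 → DifferentiableAt ℝ (fun y : E3 => k (‖y‖ ^ 2)) y := fun y hy =>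
    (hasFDerivAt_comp_norm_sq (hdk _ (hpos y hy))).differentiableAt
  have hrad₁ : ∀ y : E3, y ≠ 0 → DifferentiableAt ℝ (fun y : E3 => k₁ (‖y‖ ^ 2)) y := fun y hy =>
    (hasFDerivAt_comp_norm_sq (hdk₁ _ (hpos y hy))).differentiableAt
  have hcd : ContDiffAt ℝ 2 (fun y : E3 => inner ℝ e y * k (‖y‖ ^ 2)) z :=
    (innerSL ℝ e).contDiff.contDiffAt.mul
      ((contDiff_norm_sq ℝ).contDiffAt.rpow_const_of_ne (hpos z hz).ne')
  have hne : ∀ᶠ y in 𝓝 z, y ≠ 0 := eventually_ne_nhds hz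
  have hfirst : ∀ i, pd i (fun y : E3 => inner ℝ e y * k (‖y‖ ^ 2)) =ᶠ[𝓝 z]
      fun y => e i * k (‖y‖ ^ 2) + inner ℝ e y * (2 * (k₁ (‖y‖ ^ 2) * y i)) := by
    intro i
    filter_upwards [hne] with y hy
    rw [pd_mul (hlin y) (hrad y hy), pd_inner, pd_comp_norm_sq (hdk _ (hpos y hy))]
    ring
  have hsecond : ∀ i, pd i (pd i (fun y : E3 => inner ℝ e y * k (‖y‖ ^ 2))) z =
      4 * k₁ (‖z‖ ^ 2) * (e i * z i) +
        inner ℝ e z * (4 * k₂ (‖z‖ ^ 2) * z i ^ 2 + 2 * k₁ (‖z‖ ^ 2)) := by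
    intro i
    have hd1 : DifferentiableAt ℝ (fun y : E3 => k₁ (‖y‖ ^ 2) * y i) z :=
      (hrad₁ z hz).mul (hcoord i z)
    have hd2 : DifferentiableAt ℝ (fun y : E3 => 2 * (k₁ (‖y‖ ^ 2) * y i)) z := hd1.const_mul 2
    have hd3 : DifferentiableAt ℝ
        (fun y : E3 => inner ℝ e y * (2 * (k₁ (‖y‖ ^ 2) * y i))) z := (hlin z).mul hd2
    have hs : pd i (fun y : E3 => e i * k (‖y‖ ^ 2) + inner ℝ e y * (2 * (k₁ (‖y‖ ^ 2) * y i))) z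
        = pd i (fun y : E3 => e i * k (‖y‖ ^ 2)) z +
          pd i (fun y : E3 => inner ℝ e y * (2 * (k₁ (‖y‖ ^ 2) * y i))) z := by
      simp only [pd]
      rw [fderiv_fun_add ((hrad z hz).const_mul _) hd3, add_apply]
    have hc : ∀ (c : ℝ) (u : E3 → ℝ), DifferentiableAt ℝ u z →
        pd i (fun y => c * u y) z = c * pd i u z := by
      intro c u hu
      simp only [pd]
      rw [fderiv_const_mul hu, smul_apply, smul_eq_mul]
    rw [pd, (hfirst i).fderiv_eq, ← pd, hs, hc _ _ (hrad z hz), pd_mul (hlin z) hd2, hc _ _ hd1,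
      pd_mul (hrad₁ z hz) (hcoord i z), pd_inner, pd_comp_norm_sq (hdk _ (hpos z hz)),
      pd_comp_norm_sq (hdk₁ _ (hpos z hz)), pd_coord]
    ring
  rw [laplacian_eq_sum_pd hcd]
  simp only [hsecond]
  have hin : inner ℝ e z = ∑ i, e i * z i := by
    simp [PiLp.inner_apply, mul_comm]
  have hnorm : ‖z‖ ^ 2 = ∑ i, z i ^ 2 := EuclideanSpace.real_norm_sq_eq z
  rw [Finset.sum_add_distrib, ← Finset.mul_sum, ← hin, ← Finset.mul_sum, Finset.sum_add_distrib,
    ← Finset.mul_sum, ← hnorm]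
  -- For `k s = s ^ (-3/2)` the remaining factor `4 s k'' + 10 k'` vanishes.
  have hrel : ‖z‖ ^ 2 * (‖z‖ ^ 2) ^ (-7 / 2 : ℝ) = (‖z‖ ^ 2) ^ (-5 / 2 : ℝ) := by
    nth_rw 1 [← Real.rpow_one (‖z‖ ^ 2)]
    rw [← Real.rpow_add (hpos z hz)]
    norm_num
  simp only [hk₁, hk₂, Finset.sum_const, Finset.card_univ, Fintype.card_fin, ← hrel]
  ring

/-! ### Smoothed force kernels -/

/-- A smooth positive function equal to `1` on `(-∞, 1/2]` and to `s` on `[1, ∞)`. -/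
noncomputable def radialBase (s : ℝ) : ℝ := 1 + Real.smoothTransition (2 * s - 1) * (s - 1)

/-- A smooth positive function equal to `s ^ (-3/2)` on `[1, ∞)`. -/
noncomputable def radialProfile (s : ℝ) : ℝ := radialBase s ^ (-3 / 2 : ℝ)

/-- The kernel `⟨e, z⟩ / |z|³` of the force in direction `e`, made smooth inside the unit ball. -/
noncomputable def forceKernel (e z : E3) : ℝ := inner ℝ e z * radialProfile (‖z‖ ^ 2)

/-- The Laplacian of `forceKernel e`. -/
noncomputable def forceSource (e z : E3) : ℝ := Laplacian.laplacian (forceKernel e) z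

/-- The force kernel made smooth inside the ball of radius `δ`. -/
noncomputable def scaledKernel (e : E3) (δ : ℝ) (z : E3) : ℝ :=
  (δ⁻¹) ^ 2 * forceKernel e (δ⁻¹ • z)

theorem radialBase_of_one_le {s : ℝ} (hs : 1 ≤ s) : radialBase s = s := by
  rw [radialBase, Real.smoothTransition.one_of_one_le (by linarith)]
  ring

theorem quarter_le_radialBase (s : ℝ) : 1 / 4 ≤ radialBase s := by
  rw [radialBase]
  have h0 := Real.smoothTransition.nonneg (2 * s - 1)
  have h1 := Real.smoothTransition.le_one (2 * s - 1)
  rcases le_total s (1 / 2) with hs | hs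
  · rw [Real.smoothTransition.zero_of_nonpos (by linarith)]
    norm_num
  · nlinarith

theorem radialBase_le {s t : ℝ} (ht : 1 ≤ t) (hst : s ≤ t) : radialBase s ≤ t := by
  rw [radialBase]
  have h0 := Real.smoothTransition.nonneg (2 * s - 1)
  have h1 := Real.smoothTransition.le_one (2 * s - 1)
  rcases le_total s 1 with hs | hs
  · nlinarith
  · nlinarith

theorem radialBase_pos (s : ℝ) : 0 < radialBase s := by linarith [quarter_le_radialBase s]

theorem sq_rpow_neg_three_halves {t : ℝ} (ht : 0 < t) : (t ^ 2) ^ (-3 / 2 : ℝ) = (t ^ 3)⁻¹ := by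
  rw [← Real.rpow_natCast t 2, ← Real.rpow_mul ht.le, ← Real.rpow_natCast t 3,
    ← Real.rpow_neg ht.le]
  norm_num

theorem radialProfile_le (s : ℝ) : radialProfile s ≤ 8 := by
  have h : ((1 / 2 : ℝ) ^ 2) ≤ radialBase s :=
    le_trans (by norm_num) (quarter_le_radialBase s)
  refine (Real.rpow_le_rpow_of_nonpos (by norm_num) h (by norm_num)).trans_eq ?_
  rw [sq_rpow_neg_three_halves (by norm_num)]
  norm_num

theorem le_radialProfile {s t : ℝ} (ht : 1 ≤ t) (hst : s ≤ t ^ 2) :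
    (t ^ 3)⁻¹ ≤ radialProfile s := by
  rw [← sq_rpow_neg_three_halves (by linarith), radialProfile]
  exact Real.rpow_le_rpow_of_nonpos (radialBase_pos s) (radialBase_le (by nlinarith) hst)
    (by norm_num)

theorem contDiff_radialProfile : ContDiff ℝ ∞ radialProfile := by
  have h : ContDiff ℝ ∞ radialBase :=
    contDiff_const.add (((Real.smoothTransition.contDiff (n := ⊤)).comp
      ((contDiff_const.mul contDiff_id).sub contDiff_const)).mul
        (contDiff_id.sub contDiff_const))
  exact h.rpow_const_of_ne fun s => (radialBase_pos s).ne'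

theorem contDiff_forceKernel (e : E3) : ContDiff ℝ ∞ (forceKernel e) :=
  (innerSL ℝ e).contDiff.mul (contDiff_radialProfile.comp (contDiff_norm_sq ℝ))

theorem contDiff_scaledKernel (e : E3) (δ : ℝ) : ContDiff ℝ ∞ (scaledKernel e δ) :=
  contDiff_const.mul ((contDiff_forceKernel e).comp (contDiff_id.const_smul _))

theorem forceKernel_neg (e z : E3) : forceKernel e (-z) = -forceKernel e z := by
  simp [forceKernel]

theorem scaledKernel_neg (e : E3) (δ : ℝ) (z : E3) :
    scaledKernel e δ (-z) = -scaledKernel e δ z := by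
  simp [scaledKernel, forceKernel_neg]

theorem scaledKernel_eq (e : E3) {δ : ℝ} (hδ : 0 < δ) (z : E3) :
    scaledKernel e δ z = inner ℝ e z * ((δ⁻¹) ^ 3 * radialProfile ((‖z‖ / δ) ^ 2)) := by
  rw [scaledKernel, forceKernel, norm_smul, inner_smul_right, Real.norm_of_nonneg (by positivity),
    div_eq_inv_mul]
  ring

theorem forceKernel_of_one_le (e : E3) {z : E3} (hz : 1 ≤ ‖z‖) :
    forceKernel e z = inner ℝ e z * (‖z‖ ^ 2) ^ (-3 / 2 : ℝ) := by
  rw [forceKernel, radialProfile, radialBase_of_one_le (by nlinarith)]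

theorem scaledKernel_of_le_norm (e : E3) {δ : ℝ} (hδ : 0 < δ) {z : E3} (hz : δ ≤ ‖z‖) :
    scaledKernel e δ z = inner ℝ e z * (‖z‖ ^ 3)⁻¹ := by
  have h1 : 1 ≤ ‖z‖ / δ := (one_le_div hδ).2 hz
  rw [scaledKernel_eq e hδ, radialProfile, radialBase_of_one_le (by nlinarith),
    sq_rpow_neg_three_halves (by linarith)]
  congr 1
  field_simp

/-- Smoothing at a scale below `D` keeps the kernel at distances below `D` at least as large as
its value, per unit of `⟨e, z⟩`, at distance `D`. -/
theorem le_scaledKernel {e : E3} {δ D : ℝ} (hδ : 0 < δ) (hδD : δ ≤ D) {z : E3} (hz : ‖z‖ ≤ D)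
    (he : 0 ≤ inner ℝ e z) : inner ℝ e z * (D ^ 3)⁻¹ ≤ scaledKernel e δ z := by
  rw [scaledKernel_eq e hδ]
  refine mul_le_mul_of_nonneg_left ?_ he
  have h1 : 1 ≤ D / δ := (one_le_div hδ).2 hδD
  have h2 : (‖z‖ / δ) ^ 2 ≤ (D / δ) ^ 2 := by gcongr
  have h3 := mul_le_mul_of_nonneg_left (le_radialProfile h1 h2)
    (show 0 ≤ (δ⁻¹) ^ 3 by positivity)
  refine le_trans (le_of_eq ?_) h3
  have : 0 < D := lt_of_lt_of_le hδ hδD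
  field_simp

theorem scaledKernel_le {e : E3} {δ : ℝ} (hδ : 0 < δ) {z : E3} (he : 0 ≤ inner ℝ e z) :
    scaledKernel e δ z ≤ inner ℝ e z * (8 * (δ⁻¹) ^ 3) := by
  rw [scaledKernel_eq e hδ, mul_comm 8]
  exact mul_le_mul_of_nonneg_left
    (mul_le_mul_of_nonneg_left (radialProfile_le _) (by positivity)) he

theorem laplacian_scaledKernel_sub (e : E3) (δ : ℝ) (a y : E3) :
    Laplacian.laplacian (fun y => scaledKernel e δ (y - a)) y =
      (δ⁻¹) ^ 4 * forceSource e (δ⁻¹ • (y - a)) := by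
  have hP := contDiff_forceKernel e
  have h := InnerProductSpace.laplacian_smul (f := fun y => forceKernel e (δ⁻¹ • (y - a)))
    (x := y) ((δ⁻¹) ^ 2) ((contDiff_comp_affine hP δ⁻¹ a).contDiffAt.of_le two_le_infty)
  have h2 : (fun y => scaledKernel e δ (y - a)) =
      (δ⁻¹) ^ 2 • fun y => forceKernel e (δ⁻¹ • (y - a)) := rfl
  rw [h2, h, laplacian_comp_affine hP, smul_eq_mul, forceSource]
  ring

theorem forceSource_eq_sum (e : E3) :
    forceSource e = fun z => ∑ i, pd i (pd i (forceKernel e)) z := by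
  ext z
  exact laplacian_eq_sum_pd ((contDiff_forceKernel e).contDiffAt.of_le two_le_infty)

theorem continuous_forceSource (e : E3) : Continuous (forceSource e) := by
  rw [forceSource_eq_sum]
  exact continuous_finsetSum _ fun i _ =>
    (contDiff_pd (contDiff_pd (contDiff_forceKernel e) i) i).continuous

theorem forceSource_eq_zero (e : E3) {z : E3} (hz : 1 < ‖z‖) : forceSource e z = 0 := by
  have h : forceKernel e =ᶠ[𝓝 z] fun y : E3 => inner ℝ e y * (‖y‖ ^ 2) ^ (-3 / 2 : ℝ) := by
    filter_upwards [continuous_norm.continuousAt.eventually (lt_mem_nhds hz)] with y hy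
    exact forceKernel_of_one_le e hy.le
  rw [forceSource, (InnerProductSpace.laplacian_congr_nhds h).eq_of_nhds]
  exact laplacian_inner_mul_norm_sq_rpow e (norm_pos_iff.1 (by linarith))

theorem hasCompactSupport_forceSource (e : E3) : HasCompactSupport (forceSource e) := by
  refine HasCompactSupport.intro (isCompact_closedBall (0 : E3) 1) fun z hz => ?_
  exact forceSource_eq_zero e (by simpa using hz)

theorem forceSource_neg (e z : E3) : forceSource e (-z) = -forceSource e z := by
  have h := laplacian_comp_affine (contDiff_forceKernel e) (-1) 0 z
  have h2 : (fun y => forceKernel e ((-1 : ℝ) • (y - 0))) = -forceKernel e := by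
    ext y
    simp [forceKernel_neg]
  rw [h2, InnerProductSpace.laplacian_neg] at h
  simpa [forceSource] using h.symm

theorem integral_forceSource (e : E3) : ∫ z, forceSource e z = 0 := by
  have h : ∫ z, forceSource e (-z) = ∫ z, forceSource e z := integral_neg_eq_self _ _
  simp_rw [forceSource_neg, integral_neg] at h
  linarith

/-! ### Attraction of separated masses -/

/-- The integral of `U (x + s z) / s` against the source `forceSource e`. As the source has zero
mean, this is a signed average of the difference quotients of `U` at `x` and at scale `s`. -/
noncomputable def slopeAverage (U : E3 → ℝ) (e : E3) (s : ℝ) (x : E3) : ℝ :=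
  s⁻¹ * ∫ z, U (x + s • z) * forceSource e z

theorem integrable_mul_forceSource {u : E3 → ℝ} (hu : Continuous u) (e : E3) :
    Integrable fun z => u z * forceSource e z :=
  (hu.mul (continuous_forceSource e)).integrable_of_hasCompactSupport
    (hasCompactSupport_forceSource e).mul_left

theorem integral_mul_scaled_forceSource (U : E3 → ℝ) (e : E3) {s : ℝ} (hs : 0 < s) (x : E3) :
    ∫ y, U y * ((s⁻¹) ^ 4 * forceSource e (s⁻¹ • (y - x))) = slopeAverage U e s x := by
  have h1 := integral_add_right_eq_self (μ := volume)
    (fun y => U y * ((s⁻¹) ^ 4 * forceSource e (s⁻¹ • (y - x)))) x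
  have h2 := Measure.integral_comp_inv_smul_of_nonneg (volume : Measure E3)
    (fun z => (s⁻¹) ^ 4 * (U (x + s • z) * forceSource e z)) hs.le
  rw [← h1, slopeAverage]
  have h3 : ∀ y : E3, U (y + x) * ((s⁻¹) ^ 4 * forceSource e (s⁻¹ • (y + x - x))) =
      (s⁻¹) ^ 4 * (U (x + s • s⁻¹ • y) * forceSource e (s⁻¹ • y)) := by
    intro y
    rw [smul_inv_smul₀ hs.ne', add_sub_cancel_right, add_comm x y]
    ring
  simp_rw [h3]
  rw [h2, integral_const_mul, finrank_euclideanSpace_fin, smul_eq_mul]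
  field_simp

/-- The test function used in the Poisson equation: the force kernels smoothed at the scales `δ`
and `R` agree outside a ball, so their difference has compact support. -/
noncomputable def testKernel (e : E3) (δ R : ℝ) (z : E3) : ℝ :=
  scaledKernel e δ z - scaledKernel e R z

theorem contDiff_testKernel (e : E3) (δ R : ℝ) : ContDiff ℝ ∞ (testKernel e δ R) :=
  (contDiff_scaledKernel e δ).sub (contDiff_scaledKernel e R)

theorem testKernel_neg (e : E3) (δ R : ℝ) (z : E3) :
    testKernel e δ R (-z) = -testKernel e δ R z := by
  simp only [testKernel, scaledKernel_neg]
  ring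

theorem hasCompactSupport_testKernel (e : E3) {δ R : ℝ} (hδ : 0 < δ) (hR : 0 < R) :
    HasCompactSupport (testKernel e δ R) := by
  refine HasCompactSupport.intro (isCompact_closedBall (0 : E3) (max δ R)) fun z hz => ?_
  have hz' : max δ R < ‖z‖ := by simpa using hz
  rw [testKernel, scaledKernel_of_le_norm e hδ ((le_max_left _ _).trans hz'.le),
    scaledKernel_of_le_norm e hR ((le_max_right _ _).trans hz'.le), sub_self]

/-- The left side of the Poisson equation tested with the kernel: since `U` is bounded, the term at
the large scale `R` is small, which takes the place of Liouville's theorem. -/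
theorem integral_mul_laplacian_testKernel {U : E3 → ℝ} (hU : Continuous U) (e : E3) {δ R : ℝ}
    (hδ : 0 < δ) (hR : 0 < R) (x : E3) :
    ∫ y, U y * Laplacian.laplacian (fun y => testKernel e δ R (y - x)) y =
      slopeAverage U e δ x - slopeAverage U e R x := by
  have hcd : ∀ s, ContDiff ℝ ∞ fun y => scaledKernel e s (y - x) := fun s =>
    (contDiff_scaledKernel e s).comp (contDiff_id.sub contDiff_const)
  have hlap : ∀ y, Laplacian.laplacian (fun y => testKernel e δ R (y - x)) y =
      (δ⁻¹) ^ 4 * forceSource e (δ⁻¹ • (y - x)) - (R⁻¹) ^ 4 * forceSource e (R⁻¹ • (y - x)) := by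
    intro y
    rw [← laplacian_scaledKernel_sub, ← laplacian_scaledKernel_sub]
    exact ContDiffAt.laplacian_sub ((hcd δ).contDiffAt.of_le two_le_infty)
      ((hcd R).contDiffAt.of_le two_le_infty)
  have hint : ∀ s > 0, Integrable fun y => U y * ((s⁻¹) ^ 4 * forceSource e (s⁻¹ • (y - x))) := by
    intro s hs
    have hc : Continuous fun y => forceSource e (s⁻¹ • (y - x)) :=
      (continuous_forceSource e).comp (by fun_prop)
    have hcs : HasCompactSupport fun y => forceSource e (s⁻¹ • (y - x)) :=
      (hasCompactSupport_forceSource e).comp_homeomorph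
        ((Homeomorph.subRight x).trans (Homeomorph.smulOfNeZero s⁻¹ (inv_ne_zero hs.ne')))
    exact (hU.mul (continuous_const.mul hc)).integrable_of_hasCompactSupport
      hcs.mul_left.mul_left
  simp_rw [hlap, mul_sub]
  rw [integral_sub (hint δ hδ) (hint R hR), integral_mul_scaled_forceSource U e hδ,
    integral_mul_scaled_forceSource U e hR]

theorem stronglyMeasurable_slopeAverage {U : E3 → ℝ} (hU : Continuous U) (e : E3) (s : ℝ) :
    StronglyMeasurable (slopeAverage U e s) := by
  have hc : Continuous fun p : E3 × E3 => U (p.1 + s • p.2) * forceSource e p.2 :=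
    (hU.comp (continuous_fst.add (continuous_snd.const_smul s))).mul
      ((continuous_forceSource e).comp continuous_snd)
  exact hc.stronglyMeasurable.integral_prod_right.const_mul _

theorem norm_slopeAverage_le {U : E3 → ℝ} {M : ℝ} (hM : ∀ x, |U x| ≤ M) (e : E3) {s : ℝ}
    (hs : 0 < s) (x : E3) :
    ‖slopeAverage U e s x‖ ≤ s⁻¹ * (M * ∫ z, |forceSource e z|) := by
  rw [slopeAverage, norm_mul, Real.norm_of_nonneg (inv_pos.2 hs).le, ← integral_const_mul]
  refine mul_le_mul_of_nonneg_left ?_ (inv_pos.2 hs).le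
  refine norm_integral_le_of_norm_le ?_ (Eventually.of_forall fun z => ?_)
  · exact (((continuous_forceSource e).integrable_of_hasCompactSupport
      (hasCompactSupport_forceSource e)).abs).const_mul M
  · rw [norm_mul, Real.norm_eq_abs, Real.norm_eq_abs]
    exact mul_le_mul_of_nonneg_right (hM _) (abs_nonneg _)

theorem integrable_slopeAverage {U : E3 → ℝ} (hU : Continuous U) {M : ℝ} (hM : ∀ x, |U x| ≤ M)
    (e : E3) {s : ℝ} (hs : 0 < s) (m : Measure E3) [IsFiniteMeasure m] :
    Integrable (slopeAverage U e s) m :=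
  Integrable.of_bound (stronglyMeasurable_slopeAverage hU e s).aestronglyMeasurable _
    (Eventually.of_forall fun x => norm_slopeAverage_le hM e hs x)

theorem slopeAverage_eq {U : E3 → ℝ} (hU : Continuous U) (e : E3) (s : ℝ) (x : E3) :
    slopeAverage U e s x = ∫ z, s⁻¹ * (U (x + s • z) - U x) * forceSource e z := by
  have h1 : Integrable fun z => U (x + s • z) * forceSource e z :=
    integrable_mul_forceSource (hU.comp (continuous_const.add (continuous_const_smul s))) e
  have h2 : Integrable fun z => U x * forceSource e z :=
    integrable_mul_forceSource continuous_const e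
  simp_rw [mul_assoc, sub_mul]
  rw [integral_const_mul, integral_sub h1 h2, integral_const_mul, integral_forceSource, mul_zero,
    sub_zero, slopeAverage]

/-- The limit of `slopeAverage` as the scale tends to zero is a directional derivative of `U`, in a
direction that does not depend on the point. If the total force vanishes, so does the limit of the
integral. -/
theorem tendsto_integral_slopeAverage {U : E3 → ℝ} (hU : ContDiff ℝ 1 U) {m : Measure E3}
    [IsFiniteMeasure m] {D : ℝ} (hm : ∀ᵐ x ∂m, ‖x‖ ≤ D)
    (hforce : ∀ a, ∫ x, fderiv ℝ U x a ∂m = 0) (e : E3) :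
    Tendsto (fun δ => ∫ x, slopeAverage U e δ x ∂m) (𝓝[>] 0) (𝓝 0) := by
  obtain ⟨L, hL⟩ := (isCompact_closedBall (0 : E3) (D + 1)).exists_bound_of_continuousOn
    (hU.continuous_fderiv one_ne_zero).continuousOn
  have hq := (continuous_forceSource e).integrable_of_hasCompactSupport (μ := volume)
    (hasCompactSupport_forceSource e)
  have hbound : ∀ x : E3, ‖x‖ ≤ D → ∀ δ ∈ Set.Ioo (0 : ℝ) 1, ∀ z,
      ‖δ⁻¹ * (U (x + δ • z) - U x) * forceSource e z‖ ≤ |L| * |forceSource e z| := by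
    intro x hx δ hδ z
    rcases lt_or_ge 1 ‖z‖ with hz | hz
    · simp [forceSource_eq_zero e hz]
    have hz1 : ‖δ • z‖ ≤ δ := by
      rw [norm_smul, Real.norm_of_nonneg hδ.1.le]
      exact mul_le_of_le_one_right hδ.1.le hz
    have h := (convex_closedBall (0 : E3) (D + 1)).norm_image_sub_le_of_norm_fderiv_le (𝕜 := ℝ)
      (f := U) (C := L) (fun y _ => hU.differentiable one_ne_zero y) hL
      (x := x) (y := x + δ • z) (by simp; linarith)
      (by
        rw [mem_closedBall_zero_iff]
        exact (norm_add_le _ _).trans (by linarith [hδ.2]))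
    rw [add_sub_cancel_left] at h
    rw [norm_mul, norm_mul, Real.norm_of_nonneg (inv_pos.2 hδ.1).le,
      Real.norm_eq_abs (forceSource e z)]
    refine mul_le_mul_of_nonneg_right ?_ (abs_nonneg _)
    rw [inv_mul_le_iff₀ hδ.1, mul_comm]
    exact h.trans (mul_le_mul (le_abs_self L) hz1 (norm_nonneg _) (abs_nonneg _))
  have hIoo : ∀ᶠ δ in 𝓝[>] (0 : ℝ), δ ∈ Set.Ioo (0 : ℝ) 1 := Ioo_mem_nhdsGT one_pos
  -- Whether `a` is a multiple of `e` is irrelevant, as the force vanishes in every direction.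
  set a : E3 := ∫ z, forceSource e z • z with ha
  have hlim : ∀ x : E3, ‖x‖ ≤ D →
      Tendsto (fun δ => slopeAverage U e δ x) (𝓝[>] 0) (𝓝 (fderiv ℝ U x a)) := by
    intro x hx
    have hai : Integrable fun z : E3 => forceSource e z • z :=
      ((continuous_forceSource e).smul continuous_id).integrable_of_hasCompactSupport
        (hasCompactSupport_forceSource e).smul_right
    rw [ha, ← ContinuousLinearMap.integral_comp_comm _ hai]
    simp_rw [slopeAverage_eq hU.continuous]
    refine tendsto_integral_filter_of_dominated_convergence (fun z => |L| * |forceSource e z|)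
      ?_ ?_ (hq.abs.const_mul _) ?_
    · refine Eventually.of_forall fun δ => Continuous.aestronglyMeasurable ?_
      exact (continuous_const.mul ((hU.continuous.comp
        (continuous_const.add (continuous_const_smul δ))).sub continuous_const)).mul
          (continuous_forceSource e)
    · filter_upwards [hIoo] with δ hδ
      exact Eventually.of_forall (hbound x hx δ hδ)
    · refine Eventually.of_forall fun z => ?_
      have hd := ((hU.differentiable one_ne_zero x).hasFDerivAt.hasLineDerivAt
        z).tendsto_slope_zero_right
      simpa [mul_comm] using hd.mul_const (forceSource e z)
  suffices h : Tendsto (fun δ => ∫ x, slopeAverage U e δ x ∂m) (𝓝[>] 0)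
      (𝓝 (∫ x, fderiv ℝ U x a ∂m)) by rwa [hforce a] at h
  refine tendsto_integral_filter_of_dominated_convergence
    (fun _ => |L| * ∫ z, |forceSource e z|) ?_ ?_ (integrable_const _) ?_
  · exact Eventually.of_forall fun δ =>
      (stronglyMeasurable_slopeAverage hU.continuous e δ).aestronglyMeasurable
  · filter_upwards [hIoo] with δ hδ
    filter_upwards [hm] with x hx
    rw [slopeAverage_eq hU.continuous, ← integral_const_mul]
    exact norm_integral_le_of_norm_le (hq.abs.const_mul _)
      (Eventually.of_forall (hbound x hx δ hδ))
  · filter_upwards [hm] with x hx using hlim x hx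

theorem integrable_testKernel_sub (e : E3) {δ R : ℝ} (hδ : 0 < δ) (hR : 0 < R)
    (m m' : Measure E3) [IsFiniteMeasure m] [IsFiniteMeasure m'] :
    Integrable (fun p : E3 × E3 => testKernel e δ R (p.2 - p.1)) (m.prod m') := by
  have hc := (contDiff_testKernel e δ R).continuous
  obtain ⟨C, hC⟩ := hc.bounded_above_of_compact_support (hasCompactSupport_testKernel e hδ hR)
  exact Integrable.of_bound
    (hc.comp (continuous_snd.sub continuous_fst)).aestronglyMeasurable C
    (Eventually.of_forall fun p => hC _)

/-- Action equals reaction: the total force of a mass distribution on itself vanishes. -/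
theorem integral_testKernel_self (e : E3) (δ R : ℝ) (m : Measure E3) [IsFiniteMeasure m] :
    ∫ p : E3 × E3, testKernel e δ R (p.2 - p.1) ∂(m.prod m) = 0 := by
  have h := integral_prod_swap (μ := m) (ν := m)
    (fun p : E3 × E3 => testKernel e δ R (p.2 - p.1))
  have h2 : ∀ p : E3 × E3, testKernel e δ R (p.swap.2 - p.swap.1) =
      -testKernel e δ R (p.2 - p.1) := by
    intro p
    rw [← testKernel_neg, neg_sub]
    rfl
  simp_rw [h2, integral_neg] at h
  linarith

/-- At bounded distance, and for `R` large, the test kernel is at least a fixed positive multiple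
of `⟨e, z⟩` wherever that is nonnegative, uniformly in the small scale `δ`. -/
theorem le_testKernel {e : E3} {δ R D : ℝ} (hδ : 0 < δ) (hδD : δ ≤ D) (hR : 0 < R)
    (hDR : 16 * D ^ 3 ≤ R ^ 3) {z : E3} (hz : ‖z‖ ≤ D) (he : 0 ≤ inner ℝ e z) :
    inner ℝ e z * (2 * D ^ 3)⁻¹ ≤ testKernel e δ R z := by
  have h1 := le_scaledKernel hδ hδD hz he
  have h2 := scaledKernel_le hR he
  have hD : 0 < D := hδ.trans_le hδD
  have h3 : 8 * (R⁻¹) ^ 3 ≤ (2 * D ^ 3)⁻¹ := by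
    rw [inv_pow, ← div_eq_mul_inv, div_le_iff₀ (by positivity), inv_mul_eq_div,
      le_div_iff₀ (by positivity)]
    linarith
  have h4 := mul_le_mul_of_nonneg_left h3 he
  have h5 : inner ℝ e z * (D ^ 3)⁻¹ =
      inner ℝ e z * (2 * D ^ 3)⁻¹ + inner ℝ e z * (2 * D ^ 3)⁻¹ := by
    field_simp
    ring
  rw [testKernel]
  linarith

/-- Two nonzero masses on the two sides of a plane attract each other, so the total force
on the first cannot vanish. -/
theorem false_of_separated_of_force_eq_zero {U : E3 → ℝ} (hU : ContDiff ℝ 1 U) {M : ℝ}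
    (hM : ∀ x, |U x| ≤ M) {mA mB : Measure E3} [IsFiniteMeasure mA] [IsFiniteMeasure mB]
    {κ : ℝ} (hκ : 0 < κ)
    (hpoisson : ∀ φ : E3 → ℝ, ContDiff ℝ ∞ φ → HasCompactSupport φ →
      ∫ x, U x * Laplacian.laplacian φ x = κ * (∫ x, φ x ∂mA + ∫ x, φ x ∂mB))
    {e : E3} {c D : ℝ} (hA : ∀ᵐ x ∂mA, ‖x‖ ≤ D ∧ inner ℝ e x < c)
    (hB : ∀ᵐ x ∂mB, ‖x‖ ≤ D ∧ c < inner ℝ e x) (hA0 : mA ≠ 0) (hB0 : mB ≠ 0)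
    (hforce : ∀ a, ∫ x, fderiv ℝ U x a ∂mA = 0) : False := by
  have hlim := tendsto_integral_slopeAverage hU (hA.mono fun x hx => hx.1) hforce e
  have hD : 0 ≤ D := by
    have : (ae mA).NeBot := ae_neBot.2 hA0
    obtain ⟨x, hx⟩ := hA.exists
    exact (norm_nonneg x).trans hx.1
  have hsep : ∀ᵐ p ∂(mA.prod mB), ‖p.2 - p.1‖ ≤ 2 * D + 1 ∧ 0 < inner ℝ e (p.2 - p.1) := by
    filter_upwards [Measure.quasiMeasurePreserving_fst.ae hA,
      Measure.quasiMeasurePreserving_snd.ae hB] with p h1 h2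
    refine ⟨(norm_sub_le _ _).trans (by linarith [h1.1, h2.1]), ?_⟩
    rw [inner_sub_right]
    linarith [h1.2, h2.2]
  have hint : Integrable (fun p : E3 × E3 => inner ℝ e (p.2 - p.1)) (mA.prod mB) := by
    refine Integrable.of_bound (C := ‖e‖ * (2 * D + 1)) ?_ ?_
    · exact (continuous_const.inner (continuous_snd.sub continuous_fst)).aestronglyMeasurable
    · filter_upwards [hsep] with p hp
      exact (norm_inner_le_norm _ _).trans (mul_le_mul_of_nonneg_left hp.1 (norm_nonneg _))
  set β : ℝ := ∫ p : E3 × E3, inner ℝ e (p.2 - p.1) ∂(mA.prod mB) with hβ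
  have hβ0 : 0 < β := by
    rw [hβ, integral_pos_iff_support_of_nonneg_ae (hsep.mono fun p hp => hp.2.le) hint]
    have hfull : mA.prod mB (Function.support fun p : E3 × E3 => inner ℝ e (p.2 - p.1)) =
        mA.prod mB Set.univ :=
      measure_congr (eventuallyEq_univ.2 (hsep.mono fun p hp => hp.2.ne'))
    rw [hfull, ← Set.univ_prod_univ, Measure.prod_prod]
    exact ENNReal.mul_pos (Measure.measure_univ_ne_zero.2 hA0) (Measure.measure_univ_ne_zero.2 hB0)
  -- `E` bounds the distances between the two masses; the summand `1` keeps it positive.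
  set E : ℝ := 2 * D + 1 with hE
  have hEpos : 1 ≤ E := by linarith
  -- The Poisson equation tested with the kernel, integrated over the first mass.
  have hmain : ∀ δ > 0, ∀ R > 0,
      ∫ x, slopeAverage U e δ x ∂mA - ∫ x, slopeAverage U e R x ∂mA =
        κ * ∫ p : E3 × E3, testKernel e δ R (p.2 - p.1) ∂(mA.prod mB) := by
    intro δ hδ R hR
    have hAA := integrable_testKernel_sub e hδ hR mA mA
    have hAB := integrable_testKernel_sub e hδ hR mA mB
    rw [← integral_sub (integrable_slopeAverage hU.continuous hM e hδ mA)
      (integrable_slopeAverage hU.continuous hM e hR mA)]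
    have hpt : ∀ x, slopeAverage U e δ x - slopeAverage U e R x =
        κ * (∫ y, testKernel e δ R (y - x) ∂mA + ∫ y, testKernel e δ R (y - x) ∂mB) := by
      intro x
      rw [← integral_mul_laplacian_testKernel hU.continuous e hδ hR x]
      exact hpoisson _ ((contDiff_testKernel e δ R).comp (contDiff_id.sub contDiff_const))
        ((hasCompactSupport_testKernel e hδ hR).comp_homeomorph (Homeomorph.subRight x))
    simp_rw [hpt]
    rw [integral_const_mul, integral_add hAA.integral_prod_left hAB.integral_prod_left,
      ← integral_prod _ hAA, ← integral_prod _ hAB, integral_testKernel_self, zero_add]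
  have hlower : ∀ δ > 0, δ ≤ E → ∀ R > 0, 16 * E ^ 3 ≤ R ^ 3 →
      (2 * E ^ 3)⁻¹ * β ≤ ∫ p : E3 × E3, testKernel e δ R (p.2 - p.1) ∂(mA.prod mB) := by
    intro δ hδ hδE R hR hRE
    rw [hβ, mul_comm, ← integral_mul_const]
    refine integral_mono_ae (hint.mul_const _) (integrable_testKernel_sub e hδ hR mA mB) ?_
    filter_upwards [hsep] with p hp
    exact le_testKernel hδ hδE hR hRE hp.1 hp.2.le
  set Q : ℝ := M * ∫ z, |forceSource e z| with hQ
  have hupper : ∀ R > 0, |∫ x, slopeAverage U e R x ∂mA| ≤ R⁻¹ * (Q * mA.real Set.univ) := by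
    intro R hR
    rw [← mul_assoc]
    exact norm_integral_le_of_norm_le_const
      (Eventually.of_forall fun x => norm_slopeAverage_le hM e hR x)
  set γ : ℝ := κ * ((2 * E ^ 3)⁻¹ * β) with hγ
  have hγ0 : 0 < γ := by positivity
  have hR0 : ∀ᶠ R : ℝ in atTop, R⁻¹ * (Q * mA.real Set.univ) < γ / 2 := by
    have h := (tendsto_inv_atTop_zero (𝕜 := ℝ)).mul_const (Q * mA.real Set.univ)
    rw [zero_mul] at h
    exact h.eventually (gt_mem_nhds (by linarith))
  obtain ⟨R, hRs, hRp, hRE⟩ := (hR0.and ((eventually_gt_atTop 0).and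
    ((tendsto_pow_atTop (α := ℝ) (n := 3) (by norm_num)).eventually_ge_atTop (16 * E ^ 3)))).exists
  obtain ⟨δ, hδs, hδ⟩ := ((hlim.eventually (gt_mem_nhds (show (0 : ℝ) < γ / 2 by linarith))).and
    (Ioo_mem_nhdsGT (show (0 : ℝ) < E by linarith))).exists
  have h1 := hmain δ hδ.1 R hRp
  have h2 := mul_le_mul_of_nonneg_left (hlower δ hδ.1 hδ.2.le R hRp hRE) hκ.le
  have h3 := neg_le_of_abs_le ((hupper R hRp).trans hRs.le)
  rw [← hγ, ← h1] at h2
  linarith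

/-! ### Bodies as mass distributions -/

/-- The mass distribution with density `ρ` on the region `Ω`. -/
noncomputable def massMeasure (Ω : Set E3) (ρ : E3 → ℝ) : Measure E3 :=
  (volume.restrict Ω).withDensity fun x => ENNReal.ofReal (ρ x)

theorem integrableOn_of_memLp_top {Ω : Set E3} (hb : Bornology.IsBounded Ω) {ρ : E3 → ℝ}
    (hρ : MemLp ρ ⊤ (volume.restrict Ω)) : IntegrableOn ρ Ω := by
  have : IsFiniteMeasure (volume.restrict Ω) := ⟨by simpa using hb.measure_lt_top⟩
  exact hρ.integrable le_top

theorem isFiniteMeasure_massMeasure {Ω : Set E3} {ρ : E3 → ℝ} (hρ : IntegrableOn ρ Ω) :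
    IsFiniteMeasure (massMeasure Ω ρ) :=
  isFiniteMeasure_withDensity_ofReal hρ.2

theorem ae_mem_massMeasure {Ω : Set E3} (hΩ : IsOpen Ω) (ρ : E3 → ℝ) :
    ∀ᵐ x ∂massMeasure Ω ρ, x ∈ Ω :=
  (withDensity_absolutelyContinuous _ _).ae_le (ae_restrict_mem hΩ.measurableSet)

theorem integral_massMeasure {Ω : Set E3} (hΩ : IsOpen Ω) {ρ : E3 → ℝ} (hρ : IntegrableOn ρ Ω)
    (hpos : ∀ x ∈ Ω, 0 < ρ x) (g : E3 → ℝ) :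
    ∫ x, g x ∂massMeasure Ω ρ = ∫ x in Ω, ρ x * g x := by
  rw [massMeasure, integral_withDensity_eq_integral_toReal_smul₀ hρ.aemeasurable.ennreal_ofReal
    (Eventually.of_forall fun x => ENNReal.ofReal_lt_top)]
  refine setIntegral_congr_fun hΩ.measurableSet fun x hx => ?_
  simp [ENNReal.toReal_ofReal (hpos x hx).le]

theorem massMeasure_ne_zero {Ω : Set E3} (hΩ : IsOpen Ω) (hne : Ω.Nonempty) {ρ : E3 → ℝ}
    (hρ : IntegrableOn ρ Ω) (hpos : ∀ x ∈ Ω, 0 < ρ x) : massMeasure Ω ρ ≠ 0 := by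
  intro h
  rw [massMeasure, withDensity_eq_zero_iff hρ.aemeasurable.ennreal_ofReal] at h
  have h2 : ∀ᵐ x ∂volume.restrict Ω, False := by
    filter_upwards [h, ae_restrict_mem hΩ.measurableSet] with x hx hxΩ
    have : ENNReal.ofReal (ρ x) = 0 := hx
    rw [ENNReal.ofReal_eq_zero] at this
    linarith [hpos x hxΩ]
  have h3 : volume.restrict Ω = 0 := by
    simpa [ae_iff] using h2
  rw [Measure.restrict_eq_zero] at h3
  exact (hΩ.measure_pos volume hne).ne' h3

theorem exists_abs_le_of_tendsto_zero {U : E3 → ℝ} (hU : Continuous U)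
    (h : Tendsto U (cocompact E3) (𝓝 0)) : ∃ M, ∀ x, |U x| ≤ M := by
  obtain ⟨C, hC⟩ := ZeroAtInftyContinuousMap.bounded
    (ZeroAtInftyContinuousMap.mk ⟨U, hU⟩ h : ZeroAtInftyContinuousMap E3 ℝ)
  refine ⟨|U 0| + C, fun x => ?_⟩
  have h1 : |U x - U 0| ≤ C := hC x 0
  have h2 := abs_sub_abs_le_abs_sub (U x) (U 0)
  linarith

/-- The total gravitational force on each body of a static solution vanishes. -/
theorem IsStaticSolution.setIntegral_force_eq_zero {N : ℕ} {G : ℝ} {Ω : Fin N → Set E3}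
    (hΩ : ∀ α, IsBody (Ω α)) {U : E3 → ℝ} {ρ : Fin N → E3 → ℝ}
    {σ : Fin N → E3 → Matrix (Fin 3) (Fin 3) ℝ} (h : IsStaticSolution G Ω U ρ σ) (α : Fin N)
    (a : E3) : ∫ x in Ω α, ρ α x * fderiv ℝ U x a = 0 := by
  have hρ := integrableOn_of_memLp_top (hΩ α).isBounded (h.bounded_density α)
  have hint : ∀ i, IntegrableOn (fun x => ρ α x * pd i U x) (Ω α) := fun i =>
    hρ.mul_continuousOn_of_subset (continuous_pd h.contDiff_U i).continuousOn
      (hΩ α).isOpen.measurableSet (hΩ α).isBounded.isCompact_closure subset_closure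
  have hi : ∀ i, ∫ x in Ω α, ρ α x * pd i U x = 0 := fun i =>
    setIntegral_div_eq_zero (v := fun j x => σ α x i j) (hΩ α).isBounded (hΩ α).isOpen
      (hΩ α).smoothBoundary (hint i) (h.contDiff_stress α i) (h.continuous_stress α i)
      (fun x hx => h.balance α x hx i) (fun p hp ν hν => h.boundary α p hp ν hν i)
  have hsum : ∀ x, ρ α x * fderiv ℝ U x a = ∑ i, a i * (ρ α x * pd i U x) := by
    intro x
    rw [← sum_mul_pd, Finset.mul_sum]
    exact Finset.sum_congr rfl fun i _ => by ring
  simp_rw [hsum]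
  rw [integral_finsetSum _ fun i _ => (hint i).const_mul (a i)]
  refine Finset.sum_eq_zero fun i _ => ?_
  rw [integral_const_mul, hi, mul_zero]

end NewtonStatic

theorem mainTheorem2 (G : ℝ) (hG : 0 < G) (N : ℕ) (hN : 1 < N)
    (Ω : Fin N → Set NewtonStatic.E3) (hΩ : ∀ α, NewtonStatic.IsBody (Ω α))
    (hS : ∃ (n : NewtonStatic.E3) (c : ℝ), n ≠ 0 ∧ NewtonStatic.PlaneSeparates Ω n c) :
    ¬ ∃ (U : NewtonStatic.E3 → ℝ) (ρ : Fin N → NewtonStatic.E3 → ℝ)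
        (σ : Fin N → NewtonStatic.E3 → Matrix (Fin 3) (Fin 3) ℝ),
        NewtonStatic.IsStaticSolution G Ω U ρ σ := by
  classical
  rintro ⟨U, ρ, σ, h⟩
  obtain ⟨n, c, -, hside, ⟨αA, hαA⟩, ⟨αB, hαB⟩⟩ := hS
  have hopen : ∀ α, IsOpen (Ω α) := fun α => (hΩ α).isOpen
  have hpos := h.density_pos
  have hρ : ∀ α, IntegrableOn (ρ α) (Ω α) := fun α =>
    NewtonStatic.integrableOn_of_memLp_top (hΩ α).isBounded (h.bounded_density α)
  set m : Fin N → Measure NewtonStatic.E3 := fun α => NewtonStatic.massMeasure (Ω α) (ρ α) with hm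
  have hfin : ∀ α, IsFiniteMeasure (m α) := fun α =>
    NewtonStatic.isFiniteMeasure_massMeasure (hρ α)
  have hm0 : ∀ α, m α ≠ 0 := fun α =>
    NewtonStatic.massMeasure_ne_zero (hopen α) (hΩ α).isConnected.nonempty (hρ α) (hpos α)
  have hmint : ∀ α (g : NewtonStatic.E3 → ℝ), ∫ x, g x ∂m α = ∫ x in Ω α, ρ α x * g x :=
    fun α => NewtonStatic.integral_massMeasure (hopen α) (hρ α) (hpos α)
  have hmcont : ∀ α (g : NewtonStatic.E3 → ℝ), Continuous g → Integrable g (m α) := by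
    intro α g hg
    obtain ⟨C, hC⟩ :=
      (hΩ α).isBounded.isCompact_closure.exists_bound_of_continuousOn hg.continuousOn
    refine Integrable.of_bound hg.aestronglyMeasurable C ?_
    filter_upwards [NewtonStatic.ae_mem_massMeasure (hopen α) (ρ α)] with x hx
      using hC x (subset_closure hx)
  obtain ⟨D, hD⟩ : ∃ D, ∀ α, ∀ x ∈ Ω α, ‖x‖ ≤ D := by
    obtain ⟨D, hD⟩ := (Bornology.isBounded_iUnion.2 fun α => (hΩ α).isBounded).exists_norm_le
    exact ⟨D, fun α x hx => hD x (Set.mem_iUnion.2 ⟨α, hx⟩)⟩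
  -- The bodies on the lower side of the plane; the complement holds those on the upper side.
  set A : Finset (Fin N) := Finset.univ.filter fun α => ∀ x ∈ Ω α, inner ℝ n x < c with hA
  have hAmem : ∀ α, α ∈ A ↔ ∀ x ∈ Ω α, inner ℝ n x < c := fun α => by simp [hA]
  have hAc : ∀ α ∈ Aᶜ, ∀ x ∈ Ω α, c < inner ℝ n x := fun α hα =>
    (hside α).resolve_left fun hlt => Finset.mem_compl.1 hα ((hAmem α).2 hlt)
  have hBmem : αB ∈ Aᶜ := by
    rw [Finset.mem_compl, hAmem]
    intro hlt
    obtain ⟨x, hx⟩ := (hΩ αB).isConnected.nonempty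
    exact lt_asymm (hlt x hx) (hαB x hx)
  have hne : ∀ (s : Finset (Fin N)), ∀ α ∈ s, ∑ β ∈ s, m β ≠ 0 := by
    intro s α hα hs
    refine hm0 α (Measure.measure_univ_eq_zero.1 ?_)
    have h1 : (∑ β ∈ s, m β) Set.univ = 0 := by rw [hs]; rfl
    rw [Measure.finsetSum_apply, Finset.sum_eq_zero_iff] at h1
    exact h1 α hα
  obtain ⟨M, hM⟩ := NewtonStatic.exists_abs_le_of_tendsto_zero h.contDiff_U.continuous h.tendsto_U
  refine NewtonStatic.false_of_separated_of_force_eq_zero (mA := ∑ α ∈ A, m α)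
    (mB := ∑ α ∈ Aᶜ, m α) (κ := 4 * Real.pi * G) (e := n) (c := c) (D := D)
    h.contDiff_U hM (by positivity) ?_ ?_ ?_ (hne A αA ((hAmem αA).2 hαA)) (hne _ αB hBmem) ?_
  · intro φ hφ hφc
    rw [h.poisson φ hφ hφc, integral_finsetSum_measure fun α _ => hmcont α φ hφ.continuous,
      integral_finsetSum_measure fun α _ => hmcont α φ hφ.continuous, Finset.sum_add_sum_compl]
    simp_rw [hmint]
  · rw [ae_finsetSum_measure_iff]
    intro α hα
    filter_upwards [NewtonStatic.ae_mem_massMeasure (hopen α) (ρ α)] with x hx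
    exact ⟨hD α x hx, (hAmem α).1 hα x hx⟩
  · rw [ae_finsetSum_measure_iff]
    intro α hα
    filter_upwards [NewtonStatic.ae_mem_massMeasure (hopen α) (ρ α)] with x hx
    exact ⟨hD α x hx, hAc α hα x hx⟩
  · intro a
    have hc : Continuous fun x => fderiv ℝ U x a :=
      (h.contDiff_U.continuous_fderiv one_ne_zero).clm_apply continuous_const
    rw [integral_finsetSum_measure fun α _ => hmcont α _ hc]
    refine Finset.sum_eq_zero fun α _ => ?_
    rw [hmint]
    exact h.setIntegral_force_eq_zero hΩ α a
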